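/- For $n\ge 1$ let the $n$-qubit Pauli group be $\mathcal P_n=\{\pm1,\pm i\}\cdot\{I,X,Y,Z\}^{\otimes n}$. A stabiliser group is an Abelian subgroup $\mathcal S\le\mathcal P_n$ with $-I\notin\mathcal S$; its stabiliser state is $\rho_{\mathcal S}=2^{-n}\sum_{S\in\mathcal S}S$ (pure if $|\mathcal S|=2^n$, mixed otherwise). The measurements are the two-outcome POVMs with first element $E_P=(I+P)/2$, where $P$ is a Hermitian element of $\mathcal P_n$, that is, $P=\pm P^1\otimes\cdots\otimes P^n$ with letters $P^j\in\{I,X,Y,Z\}$. The concept of a state $\rho$ is $q_\rho(E)=\operatorname{Tr}(E\rho)$. For a list $L$ of Hermitian Pauli operators put $\sigma_L=2^{-n}\sum_{S\in\langle L\rangle}S$. Running times are numbers of steps of a multi-stack Turing machine, and one machine works for all $n$. **Theorem (stabiliser states are efficiently PAC-learnable).** For every stabiliser state $\rho$ and every measurement $E_P$, $\operatorname{Tr}(E_P\rho)\in\{0,\tfrac12,1\}$. There are constants $C$ and $K>0$, a learning machine and a prediction machine such that for every $n\ge1$ the following hold. 1. (Learning.) For every $n$-qubit stabiliser state $\rho$,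 every $m\ge 0$ and every training set $T=\{(E_{P_i},\operatorname{Tr}(E_{P_i}\rho))\}_{i\in[m]}$, the learner, run on $T$, halts within $C(m+1)n^3$ steps (so in time $O(mn^3)$) and outputs a list $L$ of independent generators. The list $L$ is a sublist of the list of stabilisers revealed by $T$ ($P_i$ if $\operatorname{Tr}(E_{P_i}\rho)=1$, and $-P_i$ if $\operatorname{Tr}(E_{P_i}\rho)=0$) and generates the same group as that list; this group $\langle L\rangle$ is a stabiliser group. The operator $\sigma=\sigma_L$ is a normalised projector ($2^{n-|L|}\sigma$ is idempotent), $\sigma\succeq0$, $\operatorname{Tr}\sigma=1$, and $|\operatorname{Tr}(E_{P_i}\sigma)-\operatorname{Tr}(E_{P_i}\rho)|\le\eta$ for all $i\in[m]$ and every $\eta\ge0$. Moreover, for every Pauli measurement $E_{P'}$: if $P'$ or $-P'$ lies in $\langle L\rangle$, then $\operatorname{Tr}(E_{P'}\sigma)=\operatorname{Tr}(E_{P'}\rho)$; otherwise $\operatorname{Tr}(E_{P'}\sigma)=\tfrac12$. 2. (Prediction.) For every list $L$ of independent generators of an $n$-qubit stabiliser group and every Pauli measurement $E_{P'}$, the predictor,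 run on $(P',L)$, outputs the exact value of $\operatorname{Tr}(E_{P'}\sigma_L)$ within $Cn^3$ steps. Thus learning from $m\ge 1$ examples and predicting takes $O(mn^3)$ steps. 3. (Generalisation.) For every $n$-qubit stabiliser state $\rho$, every probability distribution $\mathcal D$ on the Pauli measurements, all $\varepsilon,\gamma,\delta>0$ and every $$m\ \ge\ m_Q=\frac{K}{\gamma^2\varepsilon^2}\Big(\frac{n}{\gamma^2\varepsilon^2}\log^2\frac1{\gamma\varepsilon}+\log\frac1\delta\Big),$$ if the $m$ measurements of the training set are drawn independently from $\mathcal D$, then with probability at least $1-\delta$ the hypothesis $\sigma$ of the learner satisfies $\Pr_{E\sim\mathcal D}\big[|q_\sigma(E)-q_\rho(E)|>\gamma\big]\le\varepsilon$. 4. (Efficiency.) For $\varepsilon,\gamma,\delta\in(0,1)$ and $m=\max(\lceil m_Q\rceil,0)$, the bound $C(m+1)n^3$ on the running time of the learner is at most a fixed polynomial in $n,1/\varepsilon,1/\gamma,1/\delta$. -/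

import Mathlib

/-! ### Pauli operators -/

/-- The four single-qubit Pauli letters. -/
inductive PauliLetter
  | I | X | Y | Z
  deriving DecidableEq

instance : Fintype PauliLetter :=
  ⟨{.I, .X, .Y, .Z}, fun p => by cases p <;> simp⟩

/-- The `2 × 2` matrix of a Pauli letter. -/
def PauliLetter.mat : PauliLetter → Matrix (Fin 2) (Fin 2) ℂ
  | .I => 1
  | .X => !![0, 1; 1, 0]
  | .Y => !![0, -Complex.I; Complex.I, 0]
  | .Z => !![1, 0; 0, -1]

/-- Operators on `n` qubits: the computational basis is indexed by the bit strings
`Fin n → Fin 2`, so these are `2 ^ n × 2 ^ n` complex matrices. -/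
abbrev QMat (n : ℕ) : Type := Matrix (Fin n → Fin 2) (Fin n → Fin 2) ℂ

/-- The tensor product `A₁ ⊗ ⋯ ⊗ Aₙ` of single-qubit operators. -/
def tensorMat {n : ℕ} (A : Fin n → Matrix (Fin 2) (Fin 2) ℂ) : QMat n :=
  Matrix.of fun a b => ∏ i, A i (a i) (b i)

/-- The unsigned Pauli operator `P¹ ⊗ ⋯ ⊗ Pⁿ` of a string of letters. -/
def pauliString {n : ℕ} (p : Fin n → PauliLetter) : QMat n :=
  tensorMat fun i => (p i).mat

/-- The Hermitian elements of the Pauli group: a sign (`true` means `-1`) and a string of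
letters. -/
abbrev SignedPauli (n : ℕ) : Type := Bool × (Fin n → PauliLetter)

/-- The operator `± P¹ ⊗ ⋯ ⊗ Pⁿ`. -/
def SignedPauli.mat {n : ℕ} (P : SignedPauli n) : QMat n :=
  if P.1 then -pauliString P.2 else pauliString P.2

/-- The operator `-P`. -/
def SignedPauli.opp {n : ℕ} (P : SignedPauli n) : SignedPauli n := (!P.1, P.2)

theorem tensorMat_mul {n : ℕ} (A B : Fin n → Matrix (Fin 2) (Fin 2) ℂ) :
    tensorMat A * tensorMat B = tensorMat fun i => A i * B i := by
  ext a c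
  simp only [tensorMat, Matrix.mul_apply, Matrix.of_apply]
  rw [Finset.prod_univ_sum, Fintype.piFinset_univ]
  exact Finset.sum_congr rfl fun b _ => Finset.prod_mul_distrib.symm

theorem tensorMat_one {n : ℕ} :
    tensorMat (fun _ : Fin n => (1 : Matrix (Fin 2) (Fin 2) ℂ)) = 1 := by
  ext a b
  simp only [tensorMat, Matrix.of_apply, Matrix.one_apply]
  by_cases h : a = b
  · subst h; simp
  · obtain ⟨i, hi⟩ := Function.ne_iff.mp h
    rw [if_neg h]
    exact Finset.prod_eq_zero (Finset.mem_univ i) (if_neg hi)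

theorem PauliLetter.mat_mul_self (p : PauliLetter) : p.mat * p.mat = 1 := by
  cases p <;> ext i j <;> fin_cases i <;> fin_cases j <;>
    simp [PauliLetter.mat, Matrix.mul_apply, Fin.sum_univ_two]

theorem pauliString_mul_self {n : ℕ} (p : Fin n → PauliLetter) :
    pauliString p * pauliString p = 1 := by
  simp only [pauliString, tensorMat_mul, PauliLetter.mat_mul_self, tensorMat_one]

theorem SignedPauli.mat_mul_self {n : ℕ} (P : SignedPauli n) : P.mat * P.mat = 1 := by
  unfold SignedPauli.mat
  split_ifs <;> simp [pauliString_mul_self]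

/-- A signed Pauli operator as an invertible matrix; it is its own inverse. -/
def SignedPauli.unit {n : ℕ} (P : SignedPauli n) : (QMat n)ˣ :=
  ⟨P.mat, P.mat, P.mat_mul_self, P.mat_mul_self⟩

theorem PauliLetter.exists_mul (p q : PauliLetter) :
    ∃ (k : ℕ) (r : PauliLetter), p.mat * q.mat = Complex.I ^ k • r.mat := by
  cases p <;> cases q
  · exact ⟨0, .I, by simp [PauliLetter.mat]⟩
  · exact ⟨0, .X, by simp [PauliLetter.mat]⟩
  · exact ⟨0, .Y, by simp [PauliLetter.mat]⟩
  · exact ⟨0, .Z, by simp [PauliLetter.mat]⟩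
  · exact ⟨0, .X, by simp [PauliLetter.mat]⟩
  · exact ⟨0, .I, by rw [PauliLetter.mat_mul_self, pow_zero, one_smul]; rfl⟩
  · exact ⟨1, .Z, by
      ext i j; fin_cases i <;> fin_cases j <;> simp [PauliLetter.mat, Matrix.mul_apply]⟩
  · exact ⟨3, .Y, by
      ext i j; fin_cases i <;> fin_cases j <;>
        simp [PauliLetter.mat, Matrix.mul_apply, pow_succ]⟩
  · exact ⟨0, .Y, by simp [PauliLetter.mat]⟩
  · exact ⟨3, .Z, by
      ext i j; fin_cases i <;> fin_cases j <;>
        simp [PauliLetter.mat, Matrix.mul_apply, pow_succ]⟩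
  · exact ⟨0, .I, by rw [PauliLetter.mat_mul_self, pow_zero, one_smul]; rfl⟩
  · exact ⟨1, .X, by
      ext i j; fin_cases i <;> fin_cases j <;> simp [PauliLetter.mat, Matrix.mul_apply]⟩
  · exact ⟨0, .Z, by simp [PauliLetter.mat]⟩
  · exact ⟨1, .Y, by
      ext i j; fin_cases i <;> fin_cases j <;> simp [PauliLetter.mat, Matrix.mul_apply]⟩
  · exact ⟨3, .X, by
      ext i j; fin_cases i <;> fin_cases j <;>
        simp [PauliLetter.mat, Matrix.mul_apply, pow_succ]⟩
  · exact ⟨0, .I, by rw [PauliLetter.mat_mul_self, pow_zero, one_smul]; rfl⟩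

theorem tensorMat_smul {n : ℕ} (k : Fin n → ℕ) (A : Fin n → Matrix (Fin 2) (Fin 2) ℂ) :
    (tensorMat fun i => Complex.I ^ k i • A i) = Complex.I ^ (∑ i, k i) • tensorMat A := by
  ext a b
  simp [tensorMat, Finset.prod_mul_distrib, Finset.prod_pow_eq_pow_sum]

theorem pauliString_exists_mul {n : ℕ} (p q : Fin n → PauliLetter) :
    ∃ (k : ℕ) (r : Fin n → PauliLetter),
      pauliString p * pauliString q = Complex.I ^ k • pauliString r := by
  choose k r h using fun i => PauliLetter.exists_mul (p i) (q i)
  refine ⟨∑ i, k i, r, ?_⟩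
  simp only [pauliString, tensorMat_mul, h, tensorMat_smul]

/-- The `n`-qubit Pauli group `{±1, ±i} · {I, X, Y, Z}^{⊗ n}`. -/
def pauliGroup (n : ℕ) : Subgroup (QMat n)ˣ where
  carrier := {U | ∃ (k : ℕ) (p : Fin n → PauliLetter),
    (U : QMat n) = Complex.I ^ k • pauliString p}
  mul_mem' := by
    rintro U V ⟨k, p, hU⟩ ⟨l, q, hV⟩
    obtain ⟨j, r, h⟩ := pauliString_exists_mul p q
    refine ⟨k + l + j, r, ?_⟩
    rw [Units.val_mul, hU, hV, smul_mul_smul_comm, h, smul_smul, pow_add, pow_add]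
  one_mem' := ⟨0, fun _ => .I, by
    rw [Units.val_one, pow_zero, one_smul]
    exact tensorMat_one.symm⟩
  inv_mem' := by
    rintro U ⟨k, p, hU⟩
    refine ⟨3 * k, p, ?_⟩
    refine Units.inv_eq_of_mul_eq_one_right ?_
    rw [hU, smul_mul_smul_comm, pauliString_mul_self, ← pow_add]
    have : k + 3 * k = 4 * k := by ring
    rw [this, pow_mul, Complex.I_pow_four, one_pow, one_smul]

/-! ### Stabiliser states -/

/-- Stabiliser groups: Abelian subgroups of the Pauli group that do not contain `-I`. -/
def IsStabiliserGroup {n : ℕ} (S : Subgroup (QMat n)ˣ) : Prop :=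
  S ≤ pauliGroup n ∧ (∀ U ∈ S, ∀ V ∈ S, U * V = V * U) ∧ (-1 : (QMat n)ˣ) ∉ S

/-- The operator `2⁻ⁿ ∑_{U ∈ S} U`; the sum is finite for every subgroup of the Pauli group. -/
noncomputable def stabState {n : ℕ} (S : Subgroup (QMat n)ˣ) : QMat n :=
  ((2 : ℂ) ^ n)⁻¹ • ∑ᶠ U ∈ S, (U : QMat n)

/-- Stabiliser states: the state `2⁻ⁿ ∑_{U ∈ S} U` of a stabiliser group `S`. It is pure if
`|S| = 2 ^ n` and mixed if `|S| < 2 ^ n`. -/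
def IsStabiliserState {n : ℕ} (ρ : QMat n) : Prop :=
  ∃ S : Subgroup (QMat n)ˣ, IsStabiliserGroup S ∧ ρ = stabState S

/-- The group generated by a list of signed Pauli operators. -/
def genGroup {n : ℕ} (L : List (SignedPauli n)) : Subgroup (QMat n)ˣ :=
  Subgroup.closure {U | ∃ P ∈ L, U = P.unit}

/-- A list of generators is independent if removing any one of them changes the generated
group. -/
def IndependentGens {n : ℕ} (L : List (SignedPauli n)) : Prop :=
  ∀ i < L.length, genGroup (L.eraseIdx i) ≠ genGroup L

/-- The hypothesis state `2⁻ⁿ ∑_{U ∈ ⟨L⟩} U` described by a list of generators. -/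
noncomputable def hypothesisState {n : ℕ} (L : List (SignedPauli n)) : QMat n :=
  stabState (genGroup L)

/-! ### Measurements, concepts and training sets -/

/-- The POVM element `E = (I + P) / 2` of a Pauli operator `P`. -/
noncomputable def povm {n : ℕ} (P : SignedPauli n) : QMat n := (2 : ℂ)⁻¹ • (1 + P.mat)

/-- The concept `q_ρ`, which maps the measurement `E = (I + P) / 2` to `Tr (E ρ)`. -/
noncomputable def concept {n : ℕ} (ρ : QMat n) (P : SignedPauli n) : ℝ :=
  ((povm P * ρ).trace).re

/-- The labels `0`, `1/2` and `1`. -/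
inductive Outcome
  | zero | half | one
  deriving DecidableEq

instance : Fintype Outcome :=
  ⟨{.zero, .half, .one}, fun o => by cases o <;> simp⟩

/-- The number that a label stands for. -/
noncomputable def Outcome.value : Outcome → ℝ
  | .zero => 0
  | .half => 1 / 2
  | .one => 1

open Classical in
/-- The label of a number in `{0, 1/2, 1}`. -/
noncomputable def Outcome.ofReal (t : ℝ) : Outcome :=
  if t = 1 then .one else if t = 0 then .zero else .half

/-- The label of the value of `q_ρ` on the measurement of `P`. -/
noncomputable def label {n : ℕ} (ρ : QMat n) (P : SignedPauli n) : Outcome :=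
  Outcome.ofReal (concept ρ P)

/-- The training set `((E_i, Tr (E_i ρ)))_{i < m}`, where `E_i = (I + x i) / 2`. -/
noncomputable def trainingSet {n m : ℕ} (ρ : QMat n) (x : Fin m → SignedPauli n) :
    List (SignedPauli n × Outcome) :=
  List.ofFn fun i => (x i, label ρ (x i))

/-- The stabilisers `Tr (P_k ρ) P_k` that a training set reveals: `P_k` if the label is `1`,
`-P_k` if it is `0`, nothing if it is `1/2`. -/
def revealed {n : ℕ} (T : List (SignedPauli n × Outcome)) : List (SignedPauli n) :=
  T.filterMap fun e =>
    match e.2 with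
    | .one => some e.1
    | .zero => some e.1.opp
    | .half => none

open scoped ComplexOrder in
/-- `σ` is a quantum state that agrees up to `η` with `ρ` on the measurements of the training
set. -/
def IsConsistent {n m : ℕ} (η : ℝ) (x : Fin m → SignedPauli n) (ρ σ : QMat n) : Prop :=
  (∀ i, |concept σ (x i) - concept ρ (x i)| ≤ η) ∧ σ.PosSemidef ∧ σ.trace = 1

/-! ### Probabilities -/

/-- The probability of `A` under `D`. -/
noncomputable def prob {α : Type} (D : PMF α) (A : Set α) : ℝ := (D.toOuterMeasure A).toReal

open Classical in
/-- The probability of `A` when `x 0, …, x (m - 1)` are drawn independently from `D`. -/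
noncomputable def sampleProb {α : Type} [Fintype α] (D : PMF α) (m : ℕ)
    (A : Set (Fin m → α)) : ℝ :=
  ∑ x : Fin m → α, if x ∈ A then ∏ i, (D (x i)).toReal else 0

/-- The sample size `K / (γ² ε²) * (n / (γ² ε²) * log² (1 / (γ ε)) + log (1 / δ))`. -/
noncomputable def sampleBound (K : ℝ) (n : ℕ) (ε γ δ : ℝ) : ℝ :=
  K / (γ ^ 2 * ε ^ 2) *
    ((n : ℝ) / (γ ^ 2 * ε ^ 2) * Real.log (1 / (γ * ε)) ^ 2 + Real.log (1 / δ))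

/-! ### Machines

The machines are Mathlib's multi-stack Turing machines, with finitely many stacks, labels and
internal states; the running time is the number of steps. -/

/-- The finite alphabet in which inputs and outputs are written. -/
inductive Token
  | sign (b : Bool)
  | letter (p : PauliLetter)
  | outcome (o : Outcome)
  deriving DecidableEq

instance : Fintype Token :=
  Fintype.ofEquiv (Bool ⊕ PauliLetter ⊕ Outcome)
    { toFun := Sum.elim Token.sign (Sum.elim Token.letter Token.outcome)
      invFun := fun
        | .sign b => .inl b
        | .letter p => .inr (.inl p)
        | .outcome o => .inr (.inr o)
      left_inv := by rintro (_ | _ | _) <;> rfl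
      right_inv := by rintro (_ | _ | _) <;> rfl }

/-- A signed Pauli operator is written as its sign followed by its `n` letters. -/
def encodePauli {n : ℕ} (P : SignedPauli n) : List Token :=
  Token.sign P.1 :: List.ofFn fun i => Token.letter (P.2 i)

/-- A list of signed Pauli operators is written one after the other. -/
def encodeGens {n : ℕ} (L : List (SignedPauli n)) : List Token :=
  L.flatMap encodePauli

/-- A training set is written example by example, each Pauli operator followed by its label. -/
def encodeTrainingSet {n : ℕ} (T : List (SignedPauli n × Outcome)) : List Token :=
  T.flatMap fun e => encodePauli e.1 ++ [Token.outcome e.2]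

/-- Started on `input`, the machine halts with `output` within `t` steps. -/
def HaltsWithin (M : Turing.TM2ComputableAux Token Token) (input output : List Token) (t : ℕ) :
    Prop :=
  Nonempty (Turing.TM2OutputsInTime M.tm (input.map M.inputAlphabet.invFun)
    (some (output.map M.outputAlphabet.invFun)) t)

/-! ### Transition tables as multi-stack machines -/

/-- An operation on one stack: pop if the flag is set, then push the given token, if any. -/
abbrev StackOp : Type := Bool × Option Token

/-- The effect of an operation on a stack. -/
def StackOp.apply (op : StackOp) (l : List Token) : List Token :=
  op.2.toList ++ (if op.1 then l.tail else l)

section Table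

variable {K Q : Type} [DecidableEq K]

/-- Read the tops of the stacks `ks` into the registers, then continue with `s`. -/
def readTops (ks : List K) (s : Turing.TM2.Stmt (fun _ : K => Token) Q (K → Option Token)) :
    Turing.TM2.Stmt (fun _ : K => Token) Q (K → Option Token) :=
  ks.foldr (fun k s => .peek k (fun v o => Function.update v k o) s) s

/-- Perform the operations that the registers determine on the stacks `ks`, then continue
with `s`. -/
def performOps (act : (K → Option Token) → K → StackOp) (ks : List K)
    (s : Turing.TM2.Stmt (fun _ : K => Token) Q (K → Option Token)) :
    Turing.TM2.Stmt (fun _ : K => Token) Q (K → Option Token) :=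
  ks.foldr (fun k s =>
    let s' := .branch (fun v => (act v k).2.isSome)
      (.push k (fun v => (act v k).2.getD (.sign false)) s) s
    .branch (fun v => (act v k).1) (.pop k (fun v _ => v) s') s') s

theorem stepAux_readTops (ks : List K)
    (s : Turing.TM2.Stmt (fun _ : K => Token) Q (K → Option Token))
    (v : K → Option Token) (S : K → List Token) :
    Turing.TM2.stepAux (readTops ks s) v S =
      Turing.TM2.stepAux s (fun k => if k ∈ ks then (S k).head? else v k) S := by
  induction ks generalizing v with
  | nil => simp [readTops]
  | cons k ks ih =>
    have h : readTops (k :: ks) s =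
      .peek k (fun v o => Function.update v k o) (readTops ks s) := rfl
    rw [h, Turing.TM2.stepAux, ih]
    congr 1
    funext j
    by_cases h1 : j ∈ ks
    · simp [h1]
    · by_cases h2 : j = k
      · subst h2; simp [h1]
      · simp [h1, h2]

theorem stepAux_performOps (act : (K → Option Token) → K → StackOp) (ks : List K) (hks : ks.Nodup)
    (s : Turing.TM2.Stmt (fun _ : K => Token) Q (K → Option Token))
    (v : K → Option Token) (S : K → List Token) :
    Turing.TM2.stepAux (performOps act ks s) v S =
      Turing.TM2.stepAux s v (fun k => if k ∈ ks then (act v k).apply (S k) else S k) := by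
  induction ks generalizing S with
  | nil => simp [performOps]
  | cons k ks ih =>
    rw [List.nodup_cons] at hks
    have h : Turing.TM2.stepAux (performOps act (k :: ks) s) v S =
        Turing.TM2.stepAux (performOps act ks s) v
          (Function.update S k ((act v k).apply (S k))) := by
      have h' : performOps act (k :: ks) s =
        .branch (fun v => (act v k).1) (.pop k (fun v _ => v)
          (.branch (fun v => (act v k).2.isSome)
            (.push k (fun v => (act v k).2.getD (.sign false)) (performOps act ks s))
              (performOps act ks s)))
          (.branch (fun v => (act v k).2.isSome)
            (.push k (fun v => (act v k).2.getD (.sign false)) (performOps act ks s))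
              (performOps act ks s)) := rfl
      rw [h']
      rcases hop : act v k with ⟨b, _ | t⟩ <;> cases b <;>
        simp [Turing.TM2.stepAux, hop, StackOp.apply]
    rw [h, ih hks.2]
    congr 1
    funext j
    by_cases h2 : j = k
    · subst h2; simp [hks.1]
    · simp [h2]

/-- The statement that performs the transition of the control state `q`. -/
def tableStmt (δ : Q → (K → Option Token) → Option Q × (K → StackOp)) (ks : List K) (q : Q) :
    Turing.TM2.Stmt (fun _ : K => Token) Q (K → Option Token) :=
  readTops ks (performOps (fun v => (δ q v).2) ks
    (.branch (fun v => (δ q v).1.isSome) (.goto fun v => (δ q v).1.getD q)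
      (.load (fun _ _ => none) .halt)))

/-- The tops of the stacks. -/
def tops (S : K → List Token) : K → Option Token := fun k => (S k).head?

theorem step_tableStmt (δ : Q → (K → Option Token) → Option Q × (K → StackOp)) (ks : List K)
    (hks : ks.Nodup) (hall : ∀ k, k ∈ ks) (q : Q) (v : K → Option Token) (S : K → List Token) :
    Turing.TM2.step (tableStmt δ ks) ⟨some q, v, S⟩ =
      some ⟨(δ q (tops S)).1, if (δ q (tops S)).1.isSome then tops S else fun _ => none,
        fun k => ((δ q (tops S)).2 k).apply (S k)⟩ := by
  rw [Turing.TM2.step, tableStmt, stepAux_readTops, stepAux_performOps _ _ hks]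
  simp only [hall, if_true]
  change some (Turing.TM2.stepAux (.branch (fun v => (δ q v).1.isSome)
      (.goto fun v => (δ q v).1.getD q) (.load (fun _ _ => none) .halt)) (tops S) (fun k => ((δ q (tops S)).2 k).apply (S k))) = _
  rcases h : (δ q (tops S)).1 with _ | q' <;> simp [Turing.TM2.stepAux, h]

/-- `ReachIn f t c c'`: from control state and stacks `c` the machine reaches `c'` in at most `t`
steps. -/
def ReachIn (m : Q → Turing.TM2.Stmt (fun _ : K => Token) Q (K → Option Token)) (t : ℕ)
    (c c' : Q × (K → List Token)) : Prop :=
  ∃ s ≤ t, ∀ v, ∃ v', (flip bind (Turing.TM2.step m))^[s] (some ⟨some c.1, v, c.2⟩) =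
    some ⟨some c'.1, v', c'.2⟩

variable {m : Q → Turing.TM2.Stmt (fun _ : K => Token) Q (K → Option Token)}

theorem ReachIn.refl (c : Q × (K → List Token)) : ReachIn m 0 c c :=
  ⟨0, le_rfl, fun v => ⟨v, rfl⟩⟩

theorem ReachIn.trans {s t : ℕ} {a b c : Q × (K → List Token)} (h : ReachIn m s a b)
    (h' : ReachIn m t b c) : ReachIn m (s + t) a c := by
  obtain ⟨i, hi, h⟩ := h
  obtain ⟨j, hj, h'⟩ := h'
  refine ⟨j + i, by omega, fun v => ?_⟩
  obtain ⟨v', hv⟩ := h v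
  obtain ⟨v'', hv'⟩ := h' v'
  exact ⟨v'', by rw [Function.iterate_add_apply, hv, hv']⟩

theorem ReachIn.mono {s t : ℕ} {a b : Q × (K → List Token)} (h : ReachIn m s a b) (hst : s ≤ t) :
    ReachIn m t a b :=
  ⟨h.choose, h.choose_spec.1.trans hst, h.choose_spec.2⟩

theorem ReachIn.of_step {δ : Q → (K → Option Token) → Option Q × (K → StackOp)} {ks : List K}
    (hks : ks.Nodup) (hall : ∀ k, k ∈ ks) {q q' : Q} {S S' : K → List Token}
    (hq : (δ q (tops S)).1 = some q') (hS : ∀ k, ((δ q (tops S)).2 k).apply (S k) = S' k) :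
    ReachIn (tableStmt δ ks) 1 (q, S) (q', S') := by
  refine ⟨1, le_rfl, fun v => ⟨tops S, ?_⟩⟩
  change Turing.TM2.step (tableStmt δ ks) ⟨some q, v, S⟩ = _
  rw [step_tableStmt δ ks hks hall, hq]
  simp [funext hS]

theorem ReachIn.halts {δ : Q → (K → Option Token) → Option Q × (K → StackOp)} {ks : List K}
    (hks : ks.Nodup) (hall : ∀ k, k ∈ ks) {t : ℕ} {c : Q × (K → List Token)} {q : Q}
    {S : K → List Token} (h : ReachIn (tableStmt δ ks) t c (q, S))
    (hq : (δ q (tops S)).1 = none) (hS : ∀ k, ((δ q (tops S)).2 k).apply (S k) = S k) :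
    ∃ s ≤ t + 1, ∀ v, (flip bind (Turing.TM2.step (tableStmt δ ks)))^[s] (some ⟨some c.1, v, c.2⟩) =
      some ⟨none, fun _ => none, S⟩ := by
  obtain ⟨s, hs, h⟩ := h
  refine ⟨s + 1, by omega, fun v => ?_⟩
  obtain ⟨v', hv⟩ := h v
  rw [add_comm, Function.iterate_add_apply, hv]
  change Turing.TM2.step (tableStmt δ ks) ⟨some q, v', S⟩ = _
  rw [step_tableStmt δ ks hks hall, hq]
  simp [funext hS]

end Table

/-! ### The elimination machine -/

/-- The letter of the product of two Pauli letters, up to phase. -/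
def PauliLetter.mul : PauliLetter → PauliLetter → PauliLetter
  | .I, q => q
  | p, .I => p
  | .X, .X => .I
  | .Y, .Y => .I
  | .Z, .Z => .I
  | .X, .Y => .Z
  | .Y, .X => .Z
  | .Y, .Z => .X
  | .Z, .Y => .X
  | .Z, .X => .Y
  | .X, .Z => .Y

/-- The exponent of the phase `i ^ k` of the product of two Pauli letters. -/
def PauliLetter.phase : PauliLetter → PauliLetter → ZMod 4
  | .X, .Y => 1
  | .Y, .Z => 1
  | .Z, .X => 1
  | .Y, .X => 3
  | .Z, .Y => 3
  | .X, .Z => 3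
  | _, _ => 0

/-- For a letter `a` other than `I`, a linear functional on letters with value `true` at `a`. -/
def PauliLetter.bit : PauliLetter → PauliLetter → Bool
  | .I, _ => false
  | .Z, c => decide (c = .Z ∨ c = .Y)
  | _, c => decide (c = .X ∨ c = .Y)

/-- The phase exponent of a sign. -/
def signPhase (b : Bool) : ZMod 4 := if b then 2 else 0

/-- The stacks of the elimination machine. -/
inductive Stack
  | input | output | todo | rows | done | vec | aux
  deriving DecidableEq

/-- All stacks. -/
def Stack.all : List Stack := [.input, .output, .todo, .rows, .done, .vec, .aux]

theorem Stack.all_nodup : Stack.all.Nodup := by decide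

theorem Stack.mem_all (k : Stack) : k ∈ Stack.all := by cases k <;> decide

instance : Fintype Stack :=
  ⟨Stack.all.toFinset, fun k => List.mem_toFinset.mpr k.mem_all⟩

/-- The control states of the elimination machine. -/
inductive Control
  | start | main | skip
  | load (neg : Bool)
  | back (f : Bool) (k : ZMod 4)
  | next (f : Bool) (k : ZMod 4)
  | pass (d : Option Bool) (k : ZMod 4)
  | insert (k : ZMod 4)
  | discard | retract | restore | clean
  deriving Fintype

/-- The contents of the stacks. -/
def contents (i o t r d v a : List Token) : Stack → List Token
  | .input => i
  | .output => o
  | .todo => t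
  | .rows => r
  | .done => d
  | .vec => v
  | .aux => a

/-- The answer of the predictor for a reduced word: `f` tells whether a letter other than `I` is
left, `k` is the exponent of the phase. -/
def answer (f : Bool) (k : ZMod 4) : Outcome :=
  if f then .half else if k = 0 then .one else if k = 2 then .zero else .half

/-- One letter of the multiplication of a vector by a row: `d` tells whether to multiply, and is
`none` as long as only letters `I` of the row have been seen. -/
def decision (d : Option Bool) (a c : PauliLetter) : Option Bool :=
  match d with
  | some b => some b
  | none => if a = .I then none else some (a.bit c)

/-- The transition table of the learner (`learning = true`) and of the predictor. -/
def table (learning : Bool) (q : Control) (s : Stack → Option Token) :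
    Option Control × (Stack → StackOp) :=
  match q with
  | .start =>
    match s .input with
    | some t => (some .start, fun | .input => (true, none) | .todo => (false, some t)
                                  | _ => (false, none))
    | none => (some .main, fun _ => (false, none))
  | .main =>
    if learning then
      match s .todo with
      | some (.outcome .half) => (some .skip, fun | .todo => (true, none) | _ => (false, none))
      | some (.outcome .one) =>
          (some (.load false), fun | .todo => (true, none) | _ => (false, none))
      | some (.outcome .zero) =>
          (some (.load true), fun | .todo => (true, none) | _ => (false, none))
      | _ => (some .clean, fun _ => (false, none))
    else (some (.load false), fun _ => (false, none))
  | .skip =>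
    match s .todo with
    | some (.sign _) => (some .main, fun | .todo => (true, none) | _ => (false, none))
    | some _ => (some .skip, fun | .todo => (true, none) | _ => (false, none))
    | none => (some .clean, fun _ => (false, none))
  | .load neg =>
    match s .todo with
    | some (.letter c) =>
        (some (.load neg), fun | .todo => (true, none) | .aux => (false, some (.letter c))
                               | .output => (false, if learning then some (.letter c) else none)
                               | _ => (false, none))
    | some (.sign b) =>
        (some (.back false (signPhase (b ^^ neg))),
          fun | .todo => (true, none)
              | .output => (false, if learning then some (.sign (b ^^ neg)) else none)
              | _ => (false, none))
    | _ => (some .clean, fun _ => (false, none))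
  | .back f k =>
    match s .aux with
    | some (.letter c) =>
        (some (.back (f || decide (c ≠ .I)) k),
          fun | .aux => (true, none) | .vec => (false, some (.letter c)) | _ => (false, none))
    | _ => (some (.next f k), fun _ => (false, none))
  | .next f k =>
    match s .rows with
    | some _ => (some (.pass none k), fun _ => (false, none))
    | none =>
      if !learning && (s .todo).isNone then
        (some .clean, fun | .output => (false, some (.outcome (answer f k))) | _ => (false, none))
      else (some (if f then .insert k else .discard), fun _ => (false, none))
  | .pass d k =>
    match s .rows, s .vec with
    | some (.letter a), some (.letter c) =>
        (some (.pass (decision d a c) (if decision d a c = some true then k + c.phase a else k)),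
          fun | .rows => (true, none) | .done => (false, some (.letter a)) | .vec => (true, none)
              | .aux => (false, some (.letter (if decision d a c = some true then c.mul a else c)))
              | _ => (false, none))
    | some (.sign b), _ =>
        (some (.back false (if d = some true then k + signPhase b else k)),
          fun | .rows => (true, none) | .done => (false, some (.sign b)) | _ => (false, none))
    | _, _ => (some .clean, fun _ => (false, none))
  | .insert k =>
    match s .vec with
    | some t => (some (.insert k), fun | .vec => (true, none) | .done => (false, some t)
                                       | _ => (false, none))
    | none => (some .restore, fun | .done => (false, some (.sign (decide (k = 2))))
                                  | _ => (false, none))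
  | .discard =>
    match s .vec with
    | some _ => (some .discard, fun | .vec => (true, none) | _ => (false, none))
    | none => (some .retract, fun | .output => (true, none) | _ => (false, none))
  | .retract =>
    match s .output with
    | some (.letter _) => (some .retract, fun | .output => (true, none) | _ => (false, none))
    | _ => (some .restore, fun _ => (false, none))
  | .restore =>
    match s .done with
    | some t => (some .restore, fun | .done => (true, none) | .rows => (false, some t)
                                    | _ => (false, none))
    | none => (some .main, fun _ => (false, none))
  | .clean =>
    if (s .rows).isSome || (s .done).isSome || (s .vec).isSome then
      (some .clean, fun | .rows => (true, none) | .done => (true, none) | .vec => (true, none)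
                        | _ => (false, none))
    else (none, fun _ => (false, none))

/-- The learner (`learning = true`) and the predictor as multi-stack Turing machines. -/
def eliminationMachine (learning : Bool) : Turing.FinTM2 where
  K := Stack
  k₀ := .input
  k₁ := .output
  Γ := fun _ => Token
  Λ := Control
  main := .start
  σ := Stack → Option Token
  initialState := fun _ => none
  Γk₀Fin := inferInstanceAs (Fintype Token)
  m := tableStmt (table learning) Stack.all

/-- The learner and the predictor with their input and output alphabets. -/
def machine (learning : Bool) : Turing.TM2ComputableAux Token Token where
  tm := eliminationMachine learning
  inputAlphabet := Equiv.refl Token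
  outputAlphabet := Equiv.refl Token

/-- The machine goes from one control state and stack contents to another in at most `t` steps. -/
abbrev Runs (learning : Bool) (t : ℕ) (q : Control) (S : Stack → List Token) (q' : Control)
    (S' : Stack → List Token) : Prop :=
  ReachIn (tableStmt (table learning) Stack.all) t (q, S) (q', S')

theorem Runs.of_table {learning : Bool} {q q' : Control} {S S' : Stack → List Token}
    (hq : (table learning q (tops S)).1 = some q')
    (hS : ∀ k, ((table learning q (tops S)).2 k).apply (S k) = S' k) :
    Runs learning 1 q S q' S' :=
  ReachIn.of_step Stack.all_nodup Stack.mem_all hq hS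

theorem haltsWithin_machine {learning : Bool} {input output : List Token} {t : ℕ}
    (h : Runs learning t .start (contents input [] [] [] [] [] []) .clean
      (contents [] output [] [] [] [] [])) :
    HaltsWithin (machine learning) input output (t + 1) := by
  obtain ⟨s, hs, h⟩ := ReachIn.halts Stack.all_nodup Stack.mem_all h rfl
    (by intro k; cases k <;> rfl)
  refine ⟨⟨⟨s, ?_⟩, hs⟩⟩
  have h1 : Turing.initList (machine learning).tm
      (input.map (machine learning).inputAlphabet.invFun) =
      ⟨some Control.start, fun _ => none, contents input [] [] [] [] [] []⟩ := by
    have : input.map (machine learning).inputAlphabet.invFun = input := List.map_id _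
    rw [this]
    exact congrArg (Turing.TM2.Cfg.mk _ _) (funext fun k => by cases k <;> rfl)
  have h2 : Turing.haltList (machine learning).tm
      (output.map (machine learning).outputAlphabet.invFun) =
      ⟨none, fun _ => none, contents [] output [] [] [] [] []⟩ := by
    have : output.map (machine learning).outputAlphabet.invFun = output := List.map_id _
    rw [this]
    exact congrArg (Turing.TM2.Cfg.mk _ _) (funext fun k => by cases k <;> rfl)
  rw [h1, Option.map_some, h2]
  exact h _

variable {learning : Bool}

theorem runs_start (x o t r d v a : List Token) :
    Runs learning (x.length + 1) .start (contents x o t r d v a) .main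
      (contents [] o (x.reverse ++ t) r d v a) := by
  induction x generalizing t with
  | nil => exact .of_table rfl (by intro k; cases k <;> rfl)
  | cons c x ih =>
    have h : Runs learning 1 .start (contents (c :: x) o t r d v a) .start
      (contents x o (c :: t) r d v a) := .of_table rfl (by intro k; cases k <;> rfl)
    simpa [add_comm, add_left_comm] using h.trans (ih (c :: t))

theorem runs_clean (n : ℕ) (i o t r d v a : List Token) (hr : r.length ≤ n) (hd : d.length ≤ n)
    (hv : v.length ≤ n) :
    Runs learning n .clean (contents i o t r d v a) .clean (contents i o t [] [] [] a) := by
  induction n generalizing r d v with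
  | zero =>
    simp only [nonpos_iff_eq_zero, List.length_eq_zero_iff] at hr hd hv
    subst hr hd hv
    exact ReachIn.refl _
  | succ n ih =>
    by_cases h0 : r = [] ∧ d = [] ∧ v = []
    · obtain ⟨rfl, rfl, rfl⟩ := h0
      exact (ReachIn.refl _).mono (Nat.zero_le _)
    · have h : Runs learning 1 .clean (contents i o t r d v a) .clean
        (contents i o t r.tail d.tail v.tail a) := by
        apply Runs.of_table
        · cases r <;> cases d <;> cases v <;> first | rfl | exact absurd ⟨rfl, rfl, rfl⟩ h0
        · intro k
          cases r <;> cases d <;> cases v <;>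
            cases k <;> rfl
      have := h.trans (ih r.tail d.tail v.tail (by simp; omega) (by simp; omega) (by simp; omega))
      exact this.mono (by omega)

theorem runs_restore (i o t r d v a : List Token) :
    Runs learning (d.length + 1) .restore (contents i o t r d v a) .main
      (contents i o t (d.reverse ++ r) [] v a) := by
  induction d generalizing r with
  | nil => exact .of_table rfl (by intro k; cases k <;> rfl)
  | cons c d ih =>
    have h : Runs learning 1 .restore (contents i o t r (c :: d) v a) .restore
      (contents i o t (c :: r) d v a) := .of_table rfl (by intro k; cases k <;> rfl)
    simpa [add_comm, add_left_comm] using h.trans (ih (c :: r))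

theorem runs_insert (k : ZMod 4) (i o t r d v a : List Token) :
    Runs learning (v.length + 1) (.insert k) (contents i o t r d v a) .restore
      (contents i o t r (.sign (decide (k = 2)) :: (v.reverse ++ d)) [] a) := by
  induction v generalizing d with
  | nil => exact .of_table rfl (by intro k; cases k <;> rfl)
  | cons c v ih =>
    have h : Runs learning 1 (.insert k) (contents i o t r d (c :: v) a) (.insert k)
      (contents i o t r (c :: d) v a) := .of_table rfl (by intro k; cases k <;> rfl)
    simpa [add_comm, add_left_comm] using h.trans (ih (c :: d))

theorem runs_discard (i o t r d v a : List Token) :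
    Runs learning (v.length + 1) .discard (contents i o t r d v a) .retract
      (contents i o.tail t r d [] a) := by
  induction v with
  | nil => exact .of_table rfl (by intro k; cases k <;> rfl)
  | cons c v ih =>
    have h : Runs learning 1 .discard (contents i o t r d (c :: v) a) .discard
      (contents i o t r d v a) := .of_table rfl (by intro k; cases k <;> rfl)
    simpa [add_comm, add_left_comm] using h.trans ih

theorem runs_retract (w : List PauliLetter) (i o t r d v a : List Token)
    (ho : ∀ c, o.head? ≠ some (.letter c)) :
    Runs learning (w.length + 1) .retract (contents i (w.map Token.letter ++ o) t r d v a) .restore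
      (contents i o t r d v a) := by
  induction w with
  | nil =>
    rcases o with _ | ⟨c | c | c, o⟩
    · exact .of_table rfl (by intro k; cases k <;> rfl)
    · exact .of_table rfl (by intro k; cases k <;> rfl)
    · exact absurd rfl (ho c)
    · exact .of_table rfl (by intro k; cases k <;> rfl)
  | cons c w ih =>
    have h : Runs learning 1 .retract (contents i ((c :: w).map Token.letter ++ o) t r d v a) .retract
      (contents i (w.map Token.letter ++ o) t r d v a) :=
        .of_table rfl (by intro k; cases k <;> rfl)
    simpa [add_comm, add_left_comm] using h.trans ih

theorem runs_skip (w : List PauliLetter) (b : Bool) (i o t r d v a : List Token) :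
    Runs learning (w.length + 1) .skip
      (contents i o (w.map Token.letter ++ .sign b :: t) r d v a) .main (contents i o t r d v a) := by
  induction w with
  | nil => exact .of_table rfl (by intro k; cases k <;> rfl)
  | cons c w ih =>
    have h : Runs learning 1 .skip (contents i o ((c :: w).map Token.letter ++ .sign b :: t) r d v a)
      .skip (contents i o (w.map Token.letter ++ .sign b :: t) r d v a) :=
        .of_table rfl (by intro k; cases k <;> rfl)
    simpa [add_comm, add_left_comm] using h.trans ih

theorem runs_load_true (neg : Bool) (w : List PauliLetter) (b : Bool)
    (i o t r d v a : List Token) :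
    Runs true (w.length + 1) (.load neg)
      (contents i o (w.map Token.letter ++ .sign b :: t) r d v a)
      (.back false (signPhase (b ^^ neg)))
      (contents i (.sign (b ^^ neg) :: ((w.map Token.letter).reverse ++ o)) t r d v
        ((w.map Token.letter).reverse ++ a)) := by
  induction w generalizing o a with
  | nil => exact .of_table rfl (by intro k; cases k <;> rfl)
  | cons c w ih =>
    have h : Runs true 1 (.load neg)
      (contents i o ((c :: w).map Token.letter ++ .sign b :: t) r d v a)
      (.load neg) (contents i (.letter c :: o) (w.map Token.letter ++ .sign b :: t) r d v
        (.letter c :: a)) := .of_table rfl (by intro k; cases k <;> rfl)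
    simpa [add_comm, add_left_comm] using h.trans (ih (.letter c :: o) (.letter c :: a))

theorem runs_load_false (neg : Bool) (w : List PauliLetter) (b : Bool)
    (i o t r d v a : List Token) :
    Runs false (w.length + 1) (.load neg)
      (contents i o (w.map Token.letter ++ .sign b :: t) r d v a)
      (.back false (signPhase (b ^^ neg)))
      (contents i o t r d v ((w.map Token.letter).reverse ++ a)) := by
  induction w generalizing o a with
  | nil => exact .of_table rfl (by intro k; cases k <;> rfl)
  | cons c w ih =>
    have h : Runs false 1 (.load neg)
      (contents i o ((c :: w).map Token.letter ++ .sign b :: t) r d v a)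
      (.load neg) (contents i o (w.map Token.letter ++ .sign b :: t) r d v
        (.letter c :: a)) := .of_table rfl (by intro k; cases k <;> rfl)
    simpa [add_comm, add_left_comm] using h.trans (ih o (.letter c :: a))

theorem runs_back (f : Bool) (k : ZMod 4) (w : List PauliLetter) (i o t r d v : List Token) :
    Runs learning (w.length + 1) (.back f k) (contents i o t r d v (w.map Token.letter))
      (.next (f || w.any fun c => decide (c ≠ .I)) k)
      (contents i o t r d ((w.map Token.letter).reverse ++ v) []) := by
  induction w generalizing f v with
  | nil =>
    have h : Runs learning 1 (.back f k) (contents i o t r d v []) (.next f k)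
      (contents i o t r d v []) := .of_table rfl (by intro k; cases k <;> rfl)
    simpa using h
  | cons c w ih =>
    have h : Runs learning 1 (.back f k) (contents i o t r d v ((c :: w).map Token.letter))
      (.back (f || decide (c ≠ .I)) k) (contents i o t r d (.letter c :: v) (w.map Token.letter)) :=
        .of_table rfl (by intro k; cases k <;> rfl)
    simpa [add_comm, add_left_comm, Bool.or_assoc] using
      h.trans (ih (f || decide (c ≠ .I)) (.letter c :: v))

/-- The value of the pivot functional of the row `r` at the word `v`: the first letter of `r`
other than `I` decides. -/
def pivotBit : List PauliLetter → List PauliLetter → Bool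
  | a :: r, c :: v => if a = .I then pivotBit r v else a.bit c
  | _, _ => false

theorem PauliLetter.mul_I (c : PauliLetter) : c.mul .I = c := by cases c <;> rfl

theorem PauliLetter.phase_I (c : PauliLetter) : c.phase .I = 0 := by cases c <;> rfl

/-- The product of words, without the phase. -/
def mulWord (v r : List PauliLetter) : List PauliLetter := List.zipWith PauliLetter.mul v r

/-- The phase exponent of the product of words. -/
def phaseWord (v r : List PauliLetter) : ZMod 4 := (List.zipWith PauliLetter.phase v r).sum

theorem runs_pass (dec : Option Bool) (k : ZMod 4) (w u : List PauliLetter)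
    (huw : u.length = w.length) (b : Bool) (i o t r d a : List Token) :
    Runs learning (w.length + 1) (.pass dec k)
      (contents i o t (w.map Token.letter ++ .sign b :: r) d (u.map Token.letter) a)
      (.back false (if dec.getD (pivotBit w u) then k + phaseWord u w + signPhase b else k))
      (contents i o t r (.sign b :: ((w.map Token.letter).reverse ++ d)) []
        (((if dec.getD (pivotBit w u) then mulWord u w else u).map Token.letter).reverse ++ a)) := by
  induction w generalizing u dec k d a with
  | nil =>
    obtain rfl : u = [] := List.length_eq_zero_iff.mp huw
    have h : Runs learning 1 (.pass dec k) (contents i o t (.sign b :: r) d [] a)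
      (.back false (if dec = some true then k + signPhase b else k))
      (contents i o t r (.sign b :: d) [] a) := .of_table rfl (by intro k; cases k <;> rfl)
    rcases dec with _ | _ | _ <;> simpa [pivotBit, mulWord, phaseWord] using h
  | cons p w ih =>
    rcases u with _ | ⟨c, u⟩
    · simp at huw
    have h : Runs learning 1 (.pass dec k)
      (contents i o t ((p :: w).map Token.letter ++ .sign b :: r) d ((c :: u).map Token.letter) a)
      (.pass (decision dec p c) (if decision dec p c = some true then k + c.phase p else k))
      (contents i o t (w.map Token.letter ++ .sign b :: r) (.letter p :: d) (u.map Token.letter)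
        (.letter (if decision dec p c = some true then c.mul p else c) :: a)) :=
      .of_table rfl (by intro k; cases k <;> rfl)
    have h2 := h.trans (ih (decision dec p c) (if decision dec p c = some true then k + c.phase p else k)
      u (by simpa using huw) (.letter p :: d)
      (.letter (if decision dec p c = some true then c.mul p else c) :: a))
    have ht : 1 + (w.length + 1) = (p :: w).length + 1 := by simp [add_comm]
    rw [ht] at h2
    convert h2 using 2
    · rcases dec with _ | _ | _
      · by_cases hp : p = .I
        · subst hp; simp [decision, pivotBit, phaseWord, PauliLetter.phase_I]
        · rcases hb : p.bit c <;>
            simp [decision, pivotBit, phaseWord, hp, hb, add_assoc]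
      · simp [decision]
      · simp [decision, phaseWord, add_assoc]
    · simp
    · rcases dec with _ | _ | _
      · by_cases hp : p = .I
        · subst hp
          rcases hb : pivotBit w u <;> simp [decision, pivotBit, mulWord, PauliLetter.mul_I, hb]
        · rcases hb : p.bit c <;>
            simp [decision, pivotBit, mulWord, hp, hb]
      · simp [decision]
      · simp [decision, mulWord]

/-! ### Products of Pauli strings -/

/-- The phase `i ^ k`. -/
noncomputable def iPow (k : ZMod 4) : ℂ := Complex.I ^ k.val

theorem iPow_natCast (k : ℕ) : iPow (k : ZMod 4) = Complex.I ^ k := by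
  rw [iPow, ZMod.val_natCast, ← Complex.I_pow_eq_pow_mod]

theorem iPow_add (k l : ZMod 4) : iPow (k + l) = iPow k * iPow l := by
  obtain ⟨a, rfl⟩ := ZMod.natCast_zmod_surjective k
  obtain ⟨b, rfl⟩ := ZMod.natCast_zmod_surjective l
  rw [← Nat.cast_add, iPow_natCast, iPow_natCast, iPow_natCast, pow_add]

theorem iPow_zero : iPow 0 = 1 := by simpa using iPow_natCast 0

theorem iPow_one : iPow 1 = Complex.I := by simpa using iPow_natCast 1

theorem iPow_two : iPow 2 = -1 := by
  have := iPow_add 1 1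
  rw [iPow_one, Complex.I_mul_I] at this
  exact this

theorem iPow_three : iPow 3 = -Complex.I := by
  have := iPow_add 2 1
  rw [iPow_one, iPow_two, neg_one_mul] at this
  exact this

theorem iPow_ne_zero (k : ZMod 4) : iPow k ≠ 0 := pow_ne_zero _ Complex.I_ne_zero

theorem iPow_sum {ι : Type} (s : Finset ι) (k : ι → ZMod 4) :
    iPow (∑ i ∈ s, k i) = ∏ i ∈ s, iPow (k i) := by
  classical
  induction s using Finset.induction_on with
  | empty => simp [iPow_zero]
  | insert a s ha ih => rw [Finset.sum_insert ha, Finset.prod_insert ha, iPow_add, ih]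

theorem PauliLetter.mat_mul (p q : PauliLetter) :
    p.mat * q.mat = iPow (p.phase q) • (p.mul q).mat := by
  cases p <;> cases q <;>
    (ext i j; fin_cases i <;> fin_cases j <;>
      simp [PauliLetter.mat, PauliLetter.phase, PauliLetter.mul, Matrix.mul_apply, iPow_zero,
        iPow_one, iPow_three])

variable {n : ℕ}

/-- The letters of the product of two Pauli strings. -/
def mulString (p q : Fin n → PauliLetter) : Fin n → PauliLetter := fun i => (p i).mul (q i)

/-- The phase exponent of the product of two Pauli strings. -/
def phaseString (p q : Fin n → PauliLetter) : ZMod 4 := ∑ i, (p i).phase (q i)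

/-- The string of the identity. -/
def idString (n : ℕ) : Fin n → PauliLetter := fun _ => .I

theorem pauliString_mul (p q : Fin n → PauliLetter) :
    pauliString p * pauliString q = iPow (phaseString p q) • pauliString (mulString p q) := by
  simp only [pauliString, tensorMat_mul, PauliLetter.mat_mul]
  ext a b
  simp [tensorMat, Finset.prod_mul_distrib, phaseString, iPow_sum, mulString]

theorem pauliString_id : pauliString (idString n) = 1 := tensorMat_one

theorem PauliLetter.mul_eq_I_iff (p q : PauliLetter) : p.mul q = .I ↔ p = q := by
  cases p <;> cases q <;> decide

theorem mulString_eq_id_iff (p q : Fin n → PauliLetter) : mulString p q = idString n ↔ p = q := by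
  simp only [funext_iff, mulString, idString, PauliLetter.mul_eq_I_iff]

theorem PauliLetter.trace_mat (p : PauliLetter) : p.mat.trace = if p = .I then 2 else 0 := by
  cases p <;> simp [PauliLetter.mat, Matrix.trace, Fin.sum_univ_two]

theorem trace_pauliString (p : Fin n → PauliLetter) :
    (pauliString p).trace = if p = idString n then 2 ^ n else 0 := by
  have h : (pauliString p).trace = ∏ i, (p i).mat.trace := by
    simp only [Matrix.trace, Matrix.diag, pauliString, tensorMat, Matrix.of_apply]
    rw [Finset.prod_univ_sum, Fintype.piFinset_univ]
  rw [h]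
  simp only [PauliLetter.trace_mat]
  split_ifs with hp
  · subst hp; simp [idString]
  · obtain ⟨i, hi⟩ := Function.ne_iff.mp hp
    exact Finset.prod_eq_zero (Finset.mem_univ i) (if_neg hi)

theorem trace_pauliString_mul (p q : Fin n → PauliLetter) :
    (pauliString p * pauliString q).trace = if p = q then 2 ^ n else 0 := by
  split_ifs with h
  · subst h
    rw [pauliString_mul_self, ← pauliString_id, trace_pauliString, if_pos rfl]
  · rw [pauliString_mul, Matrix.trace_smul, trace_pauliString,
      if_neg (fun h' => h ((mulString_eq_id_iff p q).mp h')), smul_zero]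

theorem string_eq_of_smul_eq {a b : ℂ} (ha : a ≠ 0) {p q : Fin n → PauliLetter}
    (h : a • pauliString p = b • pauliString q) : p = q := by
  by_contra hpq
  have := congrArg (fun A => (A * pauliString p).trace) h
  simp [trace_pauliString_mul, ha, Ne.symm hpq] at this

theorem SignedPauli.mat_eq (P : SignedPauli n) :
    P.mat = iPow (signPhase P.1) • pauliString P.2 := by
  rcases P with ⟨_ | _, p⟩ <;> simp [SignedPauli.mat, signPhase, iPow_zero, iPow_two]

theorem SignedPauli.unit_opp (P : SignedPauli n) : P.opp.unit = -P.unit := by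
  ext1
  change P.opp.mat = -P.mat
  rcases P with ⟨_ | _, p⟩ <;> simp [SignedPauli.mat, SignedPauli.opp]

theorem SignedPauli.unit_mul_self (P : SignedPauli n) : P.unit * P.unit = 1 :=
  Units.ext P.mat_mul_self

theorem pauliString_ne_zero (p : Fin n → PauliLetter) : pauliString p ≠ 0 := by
  intro h
  have := pauliString_mul_self p
  rw [h, zero_mul] at this
  exact zero_ne_one this

theorem SignedPauli.unit_injective : Function.Injective (SignedPauli.unit (n := n)) := by
  intro P Q h
  have h1 : P.mat = Q.mat := congrArg Units.val h
  rw [P.mat_eq, Q.mat_eq] at h1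
  have h2 := string_eq_of_smul_eq (iPow_ne_zero _) h1
  refine Prod.ext ?_ h2
  rw [h2] at h1
  have h3 := smul_left_injective ℂ (pauliString_ne_zero Q.2) h1
  revert h3
  rcases P with ⟨_ | _, p⟩ <;> rcases Q with ⟨_ | _, q⟩ <;>
    simp [signPhase, iPow_zero, iPow_two, eq_comm] <;> norm_num

/-! ### Words and pivots -/

/-- The letters of a Pauli string, the last qubit first. -/
def word (p : Fin n → PauliLetter) : List PauliLetter := List.ofFn fun i => p i.rev

theorem length_word (p : Fin n → PauliLetter) : (word p).length = n := List.length_ofFn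

theorem mulWord_word (p q : Fin n → PauliLetter) :
    mulWord (word p) (word q) = word (mulString p q) := by
  apply List.ext_getElem <;> simp [mulWord, word, mulString]

theorem phaseWord_word (p q : Fin n → PauliLetter) :
    phaseWord (word p) (word q) = phaseString p q := by
  have h : List.zipWith PauliLetter.phase (word p) (word q) =
      List.ofFn fun i => (p (Fin.rev i)).phase (q (Fin.rev i)) := by
    apply List.ext_getElem <;> simp [word]
  rw [phaseWord, h, List.sum_ofFn, phaseString]
  exact Equiv.sum_comp Fin.revPerm fun i => (p i).phase (q i)

theorem any_word (p : Fin n → PauliLetter) :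
    ((word p).any fun c => decide (c ≠ .I)) = decide (p ≠ idString n) := by
  rw [Bool.eq_iff_iff]
  simp only [List.any_eq_true, decide_eq_true_eq, word, List.mem_ofFn,
    Function.ne_iff, idString]
  constructor
  · rintro ⟨_, ⟨i, rfl⟩, h⟩
    exact ⟨_, h⟩
  · rintro ⟨i, h⟩
    exact ⟨_, ⟨i.rev, rfl⟩, by simpa using h⟩

/-- The value of the pivot functional of `r` at `p`. -/
def pivot (r p : Fin n → PauliLetter) : Bool := pivotBit (word r) (word p)

theorem PauliLetter.bit_mul (a p q : PauliLetter) : a.bit (p.mul q) = (a.bit p ^^ a.bit q) := by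
  cases a <;> cases p <;> cases q <;> rfl

theorem PauliLetter.bit_self {a : PauliLetter} (h : a ≠ .I) : a.bit a = true := by
  cases a <;> simp_all [PauliLetter.bit]

theorem pivotBit_mulWord (r p q : List PauliLetter) (h : p.length = q.length) :
    pivotBit r (mulWord p q) = (pivotBit r p ^^ pivotBit r q) := by
  induction r generalizing p q with
  | nil => simp [pivotBit]
  | cons a r ih =>
    rcases p with _ | ⟨b, p⟩ <;> rcases q with _ | ⟨c, q⟩
    · simp [pivotBit, mulWord]
    · simp at h
    · simp at h
    · have := ih p q (by simpa using h)
      simp only [mulWord] at this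
      simp only [mulWord, List.zipWith_cons_cons, pivotBit]
      split_ifs
      · exact this
      · exact PauliLetter.bit_mul a b c

theorem pivotBit_self (r : List PauliLetter) (h : (r.any fun c => decide (c ≠ .I)) = true) :
    pivotBit r r = true := by
  induction r with
  | nil => simp at h
  | cons a r ih =>
    simp only [pivotBit]
    split_ifs with ha
    · exact ih (by simpa [ha] using h)
    · exact PauliLetter.bit_self ha

theorem pivot_mul (r p q : Fin n → PauliLetter) :
    pivot r (mulString p q) = (pivot r p ^^ pivot r q) := by
  rw [pivot, ← mulWord_word, pivotBit_mulWord _ _ _ (by simp [length_word])]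
  rfl

theorem pivot_self {r : Fin n → PauliLetter} (h : r ≠ idString n) : pivot r r = true :=
  pivotBit_self _ (by rw [any_word]; simpa using h)

theorem pivot_id (r : Fin n → PauliLetter) : pivot r (idString n) = false := by
  have h := pivot_mul r (idString n) (idString n)
  rw [(mulString_eq_id_iff _ _).mpr rfl] at h
  simpa using h

/-! ### Stabiliser groups and their states -/

theorem IsStabiliserGroup.mono {G S : Subgroup (QMat n)ˣ} (hS : IsStabiliserGroup S) (h : G ≤ S) :
    IsStabiliserGroup G :=
  ⟨h.trans hS.1, fun U hU V hV => hS.2.1 U (h hU) V (h hV), fun h1 => hS.2.2 (h h1)⟩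

theorem smul_pauliString_sq (k : ZMod 4) (p : Fin n → PauliLetter) :
    (iPow k • pauliString p) * (iPow k • pauliString p) = iPow (k + k) • 1 := by
  rw [smul_mul_smul_comm, pauliString_mul_self, iPow_add]

theorem iPow_add_self (k : ZMod 4) :
    (k = 0 ∨ k = 2) ∧ iPow (k + k) = 1 ∨ iPow (k + k) = -1 := by
  fin_cases k
  · exact Or.inl ⟨Or.inl rfl, iPow_zero⟩
  · exact Or.inr iPow_two
  · exact Or.inl ⟨Or.inr rfl, iPow_zero⟩
  · exact Or.inr iPow_two

theorem IsStabiliserGroup.phase_even {S : Subgroup (QMat n)ˣ} (hS : IsStabiliserGroup S)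
    {U : (QMat n)ˣ} (hU : U ∈ S) {k : ZMod 4} {p : Fin n → PauliLetter}
    (h : (U : QMat n) = iPow k • pauliString p) : k = 0 ∨ k = 2 := by
  rcases iPow_add_self k with h' | h'
  · exact h'.1
  · exfalso
    have h1 : U * U = -1 := by
      ext1
      rw [Units.val_mul, h, smul_pauliString_sq, h']
      simp
    exact hS.2.2 (h1 ▸ mul_mem hU hU)

theorem IsStabiliserGroup.exists_signedPauli {S : Subgroup (QMat n)ˣ} (hS : IsStabiliserGroup S)
    {U : (QMat n)ˣ} (hU : U ∈ S) : ∃ P : SignedPauli n, U = P.unit := by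
  obtain ⟨k, p, h⟩ := hS.1 hU
  rw [← iPow_natCast] at h
  rcases hS.phase_even hU h with hk | hk
  · refine ⟨(false, p), Units.ext ?_⟩
    change (U : QMat n) = SignedPauli.mat (false, p)
    rw [h, hk, SignedPauli.mat_eq]
    rfl
  · refine ⟨(true, p), Units.ext ?_⟩
    change (U : QMat n) = SignedPauli.mat (true, p)
    rw [h, hk, SignedPauli.mat_eq]
    rfl

theorem IsStabiliserGroup.mul_self {S : Subgroup (QMat n)ˣ} (hS : IsStabiliserGroup S)
    {U : (QMat n)ˣ} (hU : U ∈ S) : U * U = 1 := by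
  obtain ⟨P, rfl⟩ := hS.exists_signedPauli hU
  exact P.unit_mul_self

theorem IsStabiliserGroup.finite {S : Subgroup (QMat n)ˣ} (hS : IsStabiliserGroup S) :
    (S : Set (QMat n)ˣ).Finite :=
  (Set.finite_range (SignedPauli.unit (n := n))).subset fun U hU => by
    obtain ⟨P, rfl⟩ := hS.exists_signedPauli hU
    exact ⟨P, rfl⟩

theorem IsStabiliserGroup.not_both {S : Subgroup (QMat n)ˣ} (hS : IsStabiliserGroup S)
    {P : SignedPauli n} (h : P.unit ∈ S) : P.opp.unit ∉ S := by
  intro h'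
  have := mul_mem h h'
  rw [P.unit_opp, mul_neg, P.unit_mul_self] at this
  exact hS.2.2 this

theorem stabState_eq_sum {S : Subgroup (QMat n)ˣ} (hS : IsStabiliserGroup S) :
    stabState S = ((2 : ℂ) ^ n)⁻¹ • ∑ U ∈ hS.finite.toFinset, (U : QMat n) := by
  rw [stabState, ← finsum_mem_eq_finite_toFinset_sum _ hS.finite]
  rfl

theorem SignedPauli.trace_mul (P Q : SignedPauli n) :
    (P.mat * Q.mat).trace =
      (if Q = P then (2 : ℂ) ^ n else 0) + (if Q = P.opp then -2 ^ n else 0) := by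
  rw [P.mat_eq, Q.mat_eq, smul_mul_smul_comm, Matrix.trace_smul, trace_pauliString_mul]
  rcases P with ⟨_ | _, p⟩ <;> rcases Q with ⟨_ | _, q⟩ <;> by_cases h : p = q <;>
    simp [signPhase, iPow_zero, iPow_two, SignedPauli.opp, h, eq_comm]

open Classical in
theorem trace_mul_stabState {S : Subgroup (QMat n)ˣ} (hS : IsStabiliserGroup S)
    (P : SignedPauli n) :
    (P.mat * stabState S).trace =
      (if P.unit ∈ S then 1 else 0) + (if P.opp.unit ∈ S then -1 else 0) := by
  have h2 : (2 : ℂ) ^ n ≠ 0 := pow_ne_zero _ two_ne_zero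
  have h : ∀ U ∈ hS.finite.toFinset, (P.mat * (U : QMat n)).trace =
      (if U = P.unit then (2 : ℂ) ^ n else 0) + (if U = P.opp.unit then -2 ^ n else 0) := by
    intro U hU
    obtain ⟨Q, rfl⟩ := hS.exists_signedPauli (by simpa using hU)
    simp only [SignedPauli.unit_injective.eq_iff]
    exact P.trace_mul Q
  rw [stabState_eq_sum hS, mul_smul_comm, Matrix.trace_smul, Finset.mul_sum, Matrix.trace_sum,
    Finset.sum_congr rfl h, Finset.sum_add_distrib, Finset.sum_ite_eq', Finset.sum_ite_eq']
  simp only [Set.Finite.mem_toFinset, SetLike.mem_coe, smul_eq_mul]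
  split_ifs <;> field_simp <;> simp

theorem one_eq_unit : (1 : (QMat n)ˣ) = SignedPauli.unit (false, idString n) := by
  ext1
  change (1 : QMat n) = pauliString _
  rw [pauliString_id]

theorem trace_stabState {S : Subgroup (QMat n)ˣ} (hS : IsStabiliserGroup S) :
    (stabState S).trace = 1 := by
  have h := trace_mul_stabState hS (false, idString n)
  have h1 : SignedPauli.mat (false, idString n) = 1 := pauliString_id
  have h2 : SignedPauli.unit (false, idString n) ∈ S := one_eq_unit ▸ one_mem S
  rwa [if_pos h2, if_neg (hS.not_both h2), h1, one_mul, add_zero] at h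

theorem trace_povm_mul_stabState {S : Subgroup (QMat n)ˣ} (hS : IsStabiliserGroup S)
    (P : SignedPauli n) :
    (povm P * stabState S).trace = (1 + (P.mat * stabState S).trace) / 2 := by
  rw [povm, smul_mul_assoc, Matrix.trace_smul, add_mul, one_mul, Matrix.trace_add,
    trace_stabState hS, smul_eq_mul, inv_mul_eq_div]

theorem concept_of_mem {S : Subgroup (QMat n)ˣ} (hS : IsStabiliserGroup S) {P : SignedPauli n}
    (h : P.unit ∈ S) : concept (stabState S) P = 1 := by
  rw [concept, trace_povm_mul_stabState hS, trace_mul_stabState hS, if_pos h,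
    if_neg (hS.not_both h)]
  norm_num

theorem concept_of_opp_mem {S : Subgroup (QMat n)ˣ} (hS : IsStabiliserGroup S) {P : SignedPauli n}
    (h : P.opp.unit ∈ S) : concept (stabState S) P = 0 := by
  rw [concept, trace_povm_mul_stabState hS, trace_mul_stabState hS, if_pos h,
    if_neg (fun h' => hS.not_both h' h)]
  norm_num

theorem concept_of_not_mem {S : Subgroup (QMat n)ˣ} (hS : IsStabiliserGroup S) {P : SignedPauli n}
    (h : P.unit ∉ S) (h' : P.opp.unit ∉ S) : concept (stabState S) P = 1 / 2 := by
  rw [concept, trace_povm_mul_stabState hS, trace_mul_stabState hS, if_neg h, if_neg h']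
  norm_num

theorem label_of_mem {S : Subgroup (QMat n)ˣ} (hS : IsStabiliserGroup S) {P : SignedPauli n}
    (h : P.unit ∈ S) : label (stabState S) P = .one := by
  simp [label, concept_of_mem hS h, Outcome.ofReal]

theorem label_of_opp_mem {S : Subgroup (QMat n)ˣ} (hS : IsStabiliserGroup S) {P : SignedPauli n}
    (h : P.opp.unit ∈ S) : label (stabState S) P = .zero := by
  simp [label, concept_of_opp_mem hS h, Outcome.ofReal]

theorem label_of_not_mem {S : Subgroup (QMat n)ˣ} (hS : IsStabiliserGroup S) {P : SignedPauli n}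
    (h : P.unit ∉ S) (h' : P.opp.unit ∉ S) : label (stabState S) P = .half := by
  rw [label, concept_of_not_mem hS h h', Outcome.ofReal]
  norm_num

theorem label_eq_one_iff {S : Subgroup (QMat n)ˣ} (hS : IsStabiliserGroup S) {P : SignedPauli n} :
    label (stabState S) P = .one ↔ P.unit ∈ S := by
  refine ⟨fun h => ?_, label_of_mem hS⟩
  by_contra h1
  by_cases h2 : P.opp.unit ∈ S
  · simp [label_of_opp_mem hS h2] at h
  · simp [label_of_not_mem hS h1 h2] at h

theorem label_eq_zero_iff {S : Subgroup (QMat n)ˣ} (hS : IsStabiliserGroup S) {P : SignedPauli n} :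
    label (stabState S) P = .zero ↔ P.opp.unit ∈ S := by
  refine ⟨fun h => ?_, label_of_opp_mem hS⟩
  by_contra h1
  by_cases h2 : P.unit ∈ S
  · simp [label_of_mem hS h2] at h
  · simp [label_of_not_mem hS h2 h1] at h

theorem trace_povm_eq_label {S : Subgroup (QMat n)ˣ} (hS : IsStabiliserGroup S)
    (P : SignedPauli n) :
    (povm P * stabState S).trace = (((label (stabState S) P).value : ℝ) : ℂ) := by
  rw [trace_povm_mul_stabState hS, trace_mul_stabState hS]
  by_cases h : P.unit ∈ S
  · rw [label_of_mem hS h, if_pos h, if_neg (hS.not_both h)]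
    norm_num [Outcome.value]
  · by_cases h' : P.opp.unit ∈ S
    · rw [label_of_opp_mem hS h', if_neg h, if_pos h']
      norm_num [Outcome.value]
    · rw [label_of_not_mem hS h h', if_neg h, if_neg h']
      norm_num [Outcome.value]

/-! ### The normalised projector -/

/-- The projector `|S|⁻¹ ∑_{U ∈ S} U`. -/
noncomputable def stabProj (S : Subgroup (QMat n)ˣ) : QMat n :=
  ((2 : ℂ) ^ n / Nat.card S) • stabState S

theorem card_eq_card_toFinset {S : Subgroup (QMat n)ˣ} (hS : IsStabiliserGroup S) :
    Nat.card S = hS.finite.toFinset.card :=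
  Set.ncard_eq_toFinset_card (S : Set (QMat n)ˣ) hS.finite

theorem card_pos_of_stabiliser {S : Subgroup (QMat n)ˣ} (hS : IsStabiliserGroup S) :
    0 < Nat.card S := by
  rw [card_eq_card_toFinset hS, Finset.card_pos]
  exact ⟨1, by simp⟩

theorem stabProj_eq {S : Subgroup (QMat n)ˣ} (hS : IsStabiliserGroup S) :
    stabProj S = ((Nat.card S : ℂ))⁻¹ • ∑ U ∈ hS.finite.toFinset, (U : QMat n) := by
  rw [stabProj, stabState_eq_sum hS, smul_smul]
  congr 1
  have h2 : (2 : ℂ) ^ n ≠ 0 := pow_ne_zero _ two_ne_zero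
  field_simp

theorem isIdempotentElem_stabProj {S : Subgroup (QMat n)ˣ} (hS : IsStabiliserGroup S) :
    IsIdempotentElem (stabProj S) := by
  have hc : (Nat.card S : ℂ) ≠ 0 := Nat.cast_ne_zero.mpr (card_pos_of_stabiliser hS).ne'
  have h : ∀ U ∈ hS.finite.toFinset,
      (U : QMat n) * ∑ V ∈ hS.finite.toFinset, (V : QMat n) =
        ∑ V ∈ hS.finite.toFinset, (V : QMat n) := by
    intro U hU
    have hU' : U ∈ S := by simpa using hU
    rw [Finset.mul_sum]
    refine Finset.sum_equiv (Equiv.mulLeft U) (fun V => ?_) (fun V _ => by simp)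
    simp [S.mul_mem_cancel_left hU']
  rw [IsIdempotentElem, stabProj_eq hS, smul_mul_smul_comm, Finset.sum_mul, Finset.sum_congr rfl h,
    Finset.sum_const, ← card_eq_card_toFinset hS, ← Nat.cast_smul_eq_nsmul ℂ, smul_smul]
  congr 1
  field_simp

theorem PauliLetter.mat_conjTranspose (p : PauliLetter) : p.mat.conjTranspose = p.mat := by
  cases p <;> (ext i j; fin_cases i <;> fin_cases j <;> simp [PauliLetter.mat])

theorem pauliString_conjTranspose (p : Fin n → PauliLetter) :
    (pauliString p).conjTranspose = pauliString p := by
  ext a b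
  simp only [Matrix.conjTranspose_apply, pauliString, tensorMat, Matrix.of_apply, star_prod]
  refine Finset.prod_congr rfl fun i _ => ?_
  rw [← Matrix.conjTranspose_apply, PauliLetter.mat_conjTranspose]

theorem SignedPauli.mat_conjTranspose (P : SignedPauli n) : P.mat.conjTranspose = P.mat := by
  rcases P with ⟨_ | _, p⟩ <;> simp [SignedPauli.mat, pauliString_conjTranspose]

theorem stabProj_conjTranspose {S : Subgroup (QMat n)ˣ} (hS : IsStabiliserGroup S) :
    (stabProj S).conjTranspose = stabProj S := by
  rw [stabProj_eq hS, Matrix.conjTranspose_smul, Matrix.conjTranspose_sum]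
  congr 1
  · simp
  · refine Finset.sum_congr rfl fun U hU => ?_
    obtain ⟨P, rfl⟩ := hS.exists_signedPauli (by simpa using hU)
    exact P.mat_conjTranspose

theorem stabState_eq_smul_stabProj {S : Subgroup (QMat n)ˣ} (hS : IsStabiliserGroup S) :
    stabState S = ((Nat.card S : ℂ) / 2 ^ n) • stabProj S := by
  have hc : (Nat.card S : ℂ) ≠ 0 := Nat.cast_ne_zero.mpr (card_pos_of_stabiliser hS).ne'
  have h2 : (2 : ℂ) ^ n ≠ 0 := pow_ne_zero _ two_ne_zero
  rw [stabProj, smul_smul, div_mul_div_cancel₀ h2, div_self hc, one_smul]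

open scoped ComplexOrder in
theorem posSemidef_stabState {S : Subgroup (QMat n)ˣ} (hS : IsStabiliserGroup S) :
    (stabState S).PosSemidef := by
  rw [stabState_eq_smul_stabProj hS]
  refine Matrix.PosSemidef.smul ?_ ?_
  · have := Matrix.posSemidef_conjTranspose_mul_self (stabProj S)
    rwa [stabProj_conjTranspose hS, (isIdempotentElem_stabProj hS).eq] at this
  · have : ((Nat.card S : ℂ) / 2 ^ n) = (((Nat.card S : ℝ) / 2 ^ n : ℝ) : ℂ) := by push_cast; rfl
    rw [this]
    exact_mod_cast (by positivity : (0 : ℝ) ≤ (Nat.card S : ℝ) / 2 ^ n)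

theorem card_le_two_pow {S : Subgroup (QMat n)ˣ} (hS : IsStabiliserGroup S) :
    Nat.card S ≤ 2 ^ n := by
  have hc := card_pos_of_stabiliser hS
  have hid : IsIdempotentElem (Matrix.toLin' (stabProj S)) := by
    rw [IsIdempotentElem, Module.End.mul_eq_comp, ← Matrix.toLin'_mul,
      (isIdempotentElem_stabProj hS).eq]
  have h := (LinearMap.IsIdempotentElem.isProj_range _ hid).trace
  rw [Matrix.trace_toLin'_eq, stabProj, Matrix.trace_smul, trace_stabState hS, smul_eq_mul, mul_one,
    div_eq_iff (Nat.cast_ne_zero.mpr hc.ne')] at h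
  obtain ⟨r, h⟩ : ∃ r : ℕ, (2 : ℂ) ^ n = r * (Nat.card S : ℂ) := ⟨_, h⟩
  have h' : 2 ^ n = r * Nat.card S := by exact_mod_cast h
  rw [h']
  refine Nat.le_mul_of_pos_left _ (Nat.pos_of_ne_zero ?_)
  rintro rfl
  simp at h'

/-! ### Lists of generators -/

theorem genGroup_nil : genGroup ([] : List (SignedPauli n)) = ⊥ := by
  simp [genGroup]

theorem unit_mem_genGroup {L : List (SignedPauli n)} {P : SignedPauli n} (h : P ∈ L) :
    P.unit ∈ genGroup L :=
  Subgroup.subset_closure ⟨P, h, rfl⟩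

theorem genGroup_le_iff {L : List (SignedPauli n)} {S : Subgroup (QMat n)ˣ} :
    genGroup L ≤ S ↔ ∀ P ∈ L, P.unit ∈ S := by
  rw [genGroup, Subgroup.closure_le]
  constructor
  · intro h P hP
    exact h ⟨P, hP, rfl⟩
  · rintro h U ⟨P, hP, rfl⟩
    exact h P hP

theorem genGroup_mono {L L' : List (SignedPauli n)} (h : L ⊆ L') : genGroup L ≤ genGroup L' :=
  genGroup_le_iff.mpr fun _ hP => unit_mem_genGroup (h hP)

theorem genGroup_cons_le_iff {L : List (SignedPauli n)} {P : SignedPauli n}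
    {S : Subgroup (QMat n)ˣ} : genGroup (P :: L) ≤ S ↔ P.unit ∈ S ∧ genGroup L ≤ S := by
  simp [genGroup_le_iff]

theorem genGroup_cons_of_mem {L : List (SignedPauli n)} {P : SignedPauli n}
    (h : P.unit ∈ genGroup L) : genGroup (P :: L) = genGroup L :=
  le_antisymm (genGroup_cons_le_iff.mpr ⟨h, le_rfl⟩) (genGroup_mono (List.subset_cons_self _ _))

theorem genGroup_cons_congr {L L' : List (SignedPauli n)} (P : SignedPauli n)
    (h : genGroup L = genGroup L') : genGroup (P :: L) = genGroup (P :: L') := by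
  apply le_antisymm <;> rw [genGroup_cons_le_iff]
  · exact ⟨unit_mem_genGroup (by simp), h ▸ genGroup_mono (List.subset_cons_self _ _)⟩
  · exact ⟨unit_mem_genGroup (by simp), h ▸ genGroup_mono (List.subset_cons_self _ _)⟩

theorem mem_genGroup_cons {L : List (SignedPauli n)} {P : SignedPauli n}
    (hS : IsStabiliserGroup (genGroup (P :: L))) {U : (QMat n)ˣ} :
    U ∈ genGroup (P :: L) ↔ U ∈ genGroup L ∨ P.unit * U ∈ genGroup L := by
  have hP : P.unit ∈ genGroup (P :: L) := unit_mem_genGroup (by simp)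
  have hle : genGroup L ≤ genGroup (P :: L) := genGroup_mono (List.subset_cons_self _ _)
  have hPP := P.unit_mul_self
  have back : ∀ V, P.unit * V ∈ genGroup L → V ∈ genGroup (P :: L) := fun V hV => by
    have := mul_mem hP (hle hV)
    rwa [← mul_assoc, hPP, one_mul] at this
  constructor
  · intro hU
    induction hU using Subgroup.closure_induction with
    | mem V hV =>
      obtain ⟨Q, hQ, rfl⟩ := hV
      rcases List.mem_cons.mp hQ with rfl | hQ
      · exact Or.inr (by rw [hPP]; exact one_mem _)
      · exact Or.inl (unit_mem_genGroup hQ)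
    | one => exact Or.inl (one_mem _)
    | mul V W hV hW h1 h2 =>
      have hc := hS.2.1 _ hP _ hV
      rcases h1 with h1 | h1 <;> rcases h2 with h2 | h2
      · exact Or.inl (mul_mem h1 h2)
      · exact Or.inr (by rw [← mul_assoc, hc, mul_assoc]; exact mul_mem h1 h2)
      · exact Or.inr (by rw [← mul_assoc]; exact mul_mem h1 h2)
      · refine Or.inl ?_
        have := mul_mem h1 h2
        rwa [hc, mul_assoc, ← mul_assoc P.unit, hPP, one_mul] at this
    | inv V hV h1 =>
      rcases h1 with h1 | h1
      · exact Or.inl (inv_mem h1)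
      · refine Or.inr ?_
        have hc := hS.2.1 _ hP _ hV
        have hinv : P.unit⁻¹ = P.unit := inv_eq_of_mul_eq_one_right hPP
        have := inv_mem h1
        rwa [hc, mul_inv_rev, hinv] at this
  · rintro (h | h)
    · exact hle h
    · exact back U h

theorem card_genGroup_cons {L : List (SignedPauli n)} {P : SignedPauli n}
    (hS : IsStabiliserGroup (genGroup (P :: L))) (hP : P.unit ∉ genGroup L) :
    Nat.card (genGroup (P :: L)) = 2 * Nat.card (genGroup L) := by
  have hle : genGroup L ≤ genGroup (P :: L) := genGroup_mono (List.subset_cons_self _ _)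
  have hfin := (hS.mono hle).finite
  have hset : (genGroup (P :: L) : Set (QMat n)ˣ) =
      (genGroup L : Set (QMat n)ˣ) ∪ (fun U => P.unit * U) '' (genGroup L : Set (QMat n)ˣ) := by
    ext U
    simp only [SetLike.mem_coe, mem_genGroup_cons hS, Set.mem_union, Set.mem_image]
    refine or_congr_right ⟨fun h => ⟨_, h, ?_⟩, ?_⟩
    · rw [← mul_assoc, P.unit_mul_self, one_mul]
    · rintro ⟨V, hV, rfl⟩
      rwa [← mul_assoc, P.unit_mul_self, one_mul]
  have hdis : Disjoint (genGroup L : Set (QMat n)ˣ)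
      ((fun U => P.unit * U) '' (genGroup L : Set (QMat n)ˣ)) := by
    rw [Set.disjoint_left]
    rintro U hU ⟨V, hV, rfl⟩
    exact hP (((genGroup L).mul_mem_cancel_right hV).mp hU)
  have h : (genGroup (P :: L) : Set (QMat n)ˣ).ncard = 2 * (genGroup L : Set (QMat n)ˣ).ncard := by
    rw [hset, Set.ncard_union_eq hdis hfin (hfin.image _),
      Set.ncard_image_of_injective _ (mul_right_injective _), two_mul]
  exact h

theorem card_genGroup_le {L : List (SignedPauli n)} (hS : IsStabiliserGroup (genGroup L)) :
    Nat.card (genGroup L) ≤ 2 ^ L.length := by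
  induction L with
  | nil => simp [genGroup_nil]
  | cons P L ih =>
    have := ih (hS.mono (genGroup_mono (List.subset_cons_self _ _)))
    rw [List.length_cons, pow_succ]
    by_cases hP : P.unit ∈ genGroup L
    · rw [genGroup_cons_of_mem hP]; omega
    · rw [card_genGroup_cons hS hP]; omega

theorem independentGens_of_card {L : List (SignedPauli n)} (hS : IsStabiliserGroup (genGroup L))
    (hL : Nat.card (genGroup L) = 2 ^ L.length) : IndependentGens L := by
  intro i hi h
  have h1 : IsStabiliserGroup (genGroup (L.eraseIdx i)) := h ▸ hS
  have h2 := card_genGroup_le h1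
  rw [h, hL, List.length_eraseIdx_of_lt hi] at h2
  have := Nat.pow_lt_pow_right (a := 2) (by norm_num) (by omega : L.length - 1 < L.length)
  omega

theorem IndependentGens.tail {L : List (SignedPauli n)} {P : SignedPauli n}
    (h : IndependentGens (P :: L)) : IndependentGens L := by
  intro i hi h'
  exact h (i + 1) (by simpa using hi) (genGroup_cons_congr P h')

theorem IndependentGens.head {L : List (SignedPauli n)} {P : SignedPauli n}
    (h : IndependentGens (P :: L)) : P.unit ∉ genGroup L := fun hP =>
  h 0 (by simp) (by rw [genGroup_cons_of_mem hP]; rfl)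

theorem IndependentGens.card {L : List (SignedPauli n)} (hL : IndependentGens L)
    (hS : IsStabiliserGroup (genGroup L)) : Nat.card (genGroup L) = 2 ^ L.length := by
  induction L with
  | nil => simp [genGroup_nil]
  | cons P L ih =>
    rw [card_genGroup_cons hS hL.head,
      ih hL.tail (hS.mono (genGroup_mono (List.subset_cons_self _ _))), List.length_cons, pow_succ']

theorem IndependentGens.length_le {L : List (SignedPauli n)} (hL : IndependentGens L)
    (hS : IsStabiliserGroup (genGroup L)) : L.length ≤ n := by
  have := card_le_two_pow hS
  rw [hL.card hS] at this
  exact (Nat.pow_le_pow_iff_right (by norm_num)).mp this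

/-! ### Reduction of a Pauli string by a list of rows -/

/-- Multiply by the row `r` if the pivot functional of `r` does not vanish. -/
def reduceRow (x : ZMod 4 × (Fin n → PauliLetter)) (r : SignedPauli n) :
    ZMod 4 × (Fin n → PauliLetter) :=
  if pivot r.2 x.2 then (x.1 + phaseString x.2 r.2 + signPhase r.1, mulString x.2 r.2) else x

/-- Reduce by all rows in turn. -/
def reduce (rows : List (SignedPauli n)) (x : ZMod 4 × (Fin n → PauliLetter)) :
    ZMod 4 × (Fin n → PauliLetter) :=
  rows.foldl reduceRow x

/-- The signed Pauli operator as a string with a phase exponent. -/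
def SignedPauli.phased (P : SignedPauli n) : ZMod 4 × (Fin n → PauliLetter) := (signPhase P.1, P.2)

/-- The operator of a string with a phase exponent. -/
noncomputable def phasedMat (x : ZMod 4 × (Fin n → PauliLetter)) : QMat n :=
  iPow x.1 • pauliString x.2

theorem phasedMat_phased (P : SignedPauli n) : phasedMat P.phased = P.mat := P.mat_eq.symm

/-- The rows form a basis in echelon form of the group generated by `L`. -/
structure IsTableau (rows L : List (SignedPauli n)) : Prop where
  genGroup_eq : genGroup rows = genGroup L
  length_eq : rows.length = L.length
  pivots : rows.Pairwise fun r s => pivot r.2 s.2 = false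
  ne_id : ∀ r ∈ rows, r.2 ≠ idString n

theorem isTableau_nil : IsTableau ([] : List (SignedPauli n)) [] :=
  ⟨rfl, rfl, List.Pairwise.nil, by simp⟩

theorem phasedMat_reduceRow (x : ZMod 4 × (Fin n → PauliLetter)) (r : SignedPauli n) :
    phasedMat (reduceRow x r) = if pivot r.2 x.2 then phasedMat x * r.mat else phasedMat x := by
  rw [reduceRow]
  split_ifs
  · simp only [phasedMat]
    rw [r.mat_eq, smul_mul_smul_comm, pauliString_mul, smul_smul, iPow_add, iPow_add]
    congr 1
    ring
  · rfl

theorem exists_phasedMat_reduce (rows : List (SignedPauli n))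
    (x : ZMod 4 × (Fin n → PauliLetter)) :
    ∃ U ∈ genGroup rows, phasedMat (reduce rows x) = phasedMat x * (U : QMat n) := by
  induction rows generalizing x with
  | nil => exact ⟨1, one_mem _, by simp [reduce]⟩
  | cons r rows ih =>
    obtain ⟨U, hU, h⟩ := ih (reduceRow x r)
    have hU' := genGroup_mono (List.subset_cons_self r rows) hU
    change phasedMat (reduce (r :: rows) x) = _ at h
    rw [h, phasedMat_reduceRow]
    split_ifs
    · exact ⟨r.unit * U, mul_mem (unit_mem_genGroup (by simp)) hU', by
        rw [Units.val_mul, ← mul_assoc]; rfl⟩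
    · exact ⟨U, hU', rfl⟩

theorem pivot_reduce_of_forall (r : Fin n → PauliLetter) (rows : List (SignedPauli n))
    (h : ∀ s ∈ rows, pivot r s.2 = false) (x : ZMod 4 × (Fin n → PauliLetter)) :
    pivot r (reduce rows x).2 = pivot r x.2 := by
  induction rows generalizing x with
  | nil => rfl
  | cons s rows ih =>
    change pivot r (reduce rows (reduceRow x s)).2 = _
    rw [ih fun t ht => h t (List.mem_cons_of_mem _ ht), reduceRow]
    split_ifs
    · rw [pivot_mul, h s (by simp), Bool.xor_false]
    · rfl

theorem pivot_reduce {rows : List (SignedPauli n)}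
    (hp : rows.Pairwise fun r s => pivot r.2 s.2 = false) (hne : ∀ r ∈ rows, r.2 ≠ idString n)
    (x : ZMod 4 × (Fin n → PauliLetter)) {r : SignedPauli n} (hr : r ∈ rows) :
    pivot r.2 (reduce rows x).2 = false := by
  induction rows generalizing x with
  | nil => simp at hr
  | cons s rows ih =>
    rw [List.pairwise_cons] at hp
    change pivot r.2 (reduce rows (reduceRow x s)).2 = _
    rcases List.mem_cons.mp hr with rfl | hr
    · rw [pivot_reduce_of_forall _ _ hp.1, reduceRow]
      split_ifs with h
      · rw [pivot_mul, h, pivot_self (hne _ (by simp))]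
        rfl
      · simpa using h
    · exact ih hp.2 (fun t ht => hne t (List.mem_cons_of_mem _ ht)) _ hr

/-- The Pauli operators on which the pivot functional of `r` vanishes. -/
def pivotKer (r : Fin n → PauliLetter) : Subgroup (QMat n)ˣ where
  carrier := {U | ∃ x, (U : QMat n) = phasedMat x ∧ pivot r x.2 = false}
  one_mem' := ⟨(0, idString n), by simp [phasedMat, iPow_zero, pauliString_id], pivot_id r⟩
  mul_mem' := by
    rintro U V ⟨x, hU, hx⟩ ⟨y, hV, hy⟩
    refine ⟨(x.1 + y.1 + phaseString x.2 y.2, mulString x.2 y.2), ?_, by rw [pivot_mul, hx, hy]; rfl⟩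
    rw [Units.val_mul, hU, hV]
    simp only [phasedMat]
    rw [smul_mul_smul_comm, pauliString_mul, smul_smul, iPow_add, iPow_add]
  inv_mem' := by
    rintro U ⟨x, hU, hx⟩
    refine ⟨(-x.1, x.2), Units.inv_eq_of_mul_eq_one_right ?_, hx⟩
    rw [hU, phasedMat, phasedMat, smul_mul_smul_comm, pauliString_mul_self, ← iPow_add,
      add_neg_cancel, iPow_zero, one_smul]

theorem pivot_eq_false_of_mem {r : Fin n → PauliLetter} {rows : List (SignedPauli n)}
    (h : ∀ s ∈ rows, pivot r s.2 = false) {U : (QMat n)ˣ} (hU : U ∈ genGroup rows)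
    {x : ZMod 4 × (Fin n → PauliLetter)} (hx : (U : QMat n) = phasedMat x) :
    pivot r x.2 = false := by
  have hle : genGroup rows ≤ pivotKer r :=
    genGroup_le_iff.mpr fun s hs => ⟨s.phased, (phasedMat_phased s).symm, h s hs⟩
  obtain ⟨y, hy, hy'⟩ := hle hU
  rwa [string_eq_of_smul_eq (iPow_ne_zero _) (hx.symm.trans hy)]

theorem eq_id_of_mem_of_pivots {rows : List (SignedPauli n)}
    (hS : IsStabiliserGroup (genGroup rows))
    (hp : rows.Pairwise fun r s => pivot r.2 s.2 = false) (hne : ∀ r ∈ rows, r.2 ≠ idString n)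
    {U : (QMat n)ˣ} (hU : U ∈ genGroup rows) {x : ZMod 4 × (Fin n → PauliLetter)}
    (hx : (U : QMat n) = phasedMat x) (h : ∀ r ∈ rows, pivot r.2 x.2 = false) :
    x.2 = idString n := by
  induction rows generalizing U x with
  | nil =>
    rw [genGroup_nil, Subgroup.mem_bot] at hU
    rw [hU, Units.val_one, ← pauliString_id, ← one_smul ℂ (pauliString (idString n))] at hx
    exact (string_eq_of_smul_eq one_ne_zero hx).symm
  | cons r rows ih =>
    rw [List.pairwise_cons] at hp
    rcases (mem_genGroup_cons hS).mp hU with hU | hU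
    · exact ih (hS.mono (genGroup_mono (List.subset_cons_self _ _))) hp.2
        (fun t ht => hne t (List.mem_cons_of_mem _ ht)) hU hx
        (fun t ht => h t (List.mem_cons_of_mem _ ht))
    · exfalso
      have hx' : ((r.unit * U : (QMat n)ˣ) : QMat n) =
          phasedMat (signPhase r.1 + x.1 + phaseString r.2 x.2, mulString r.2 x.2) := by
        rw [Units.val_mul, hx]
        change r.mat * _ = _
        simp only [phasedMat]
        rw [r.mat_eq, smul_mul_smul_comm, pauliString_mul, smul_smul, iPow_add, iPow_add]
      have := pivot_eq_false_of_mem hp.1 hU hx'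
      simp [pivot_mul, pivot_self (hne r (by simp)), h r (by simp)] at this

variable {rows L : List (SignedPauli n)}

theorem reduce_eq_id_of_mem (hS : IsStabiliserGroup (genGroup L)) (hT : IsTableau rows L)
    {P : SignedPauli n} (hP : P.unit ∈ genGroup L ∨ P.opp.unit ∈ genGroup L) :
    (reduce rows P.phased).2 = idString n := by
  rw [← hT.genGroup_eq] at hS hP
  obtain ⟨U, hU, h⟩ := exists_phasedMat_reduce rows P.phased
  have hpiv := fun r (hr : r ∈ rows) => pivot_reduce hT.pivots hT.ne_id P.phased hr
  rw [phasedMat_phased] at h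
  rcases hP with hP | hP
  · exact eq_id_of_mem_of_pivots hS hT.pivots hT.ne_id (mul_mem hP hU) h.symm hpiv
  · refine eq_id_of_mem_of_pivots hS hT.pivots hT.ne_id (mul_mem hP hU)
      (x := (2 + (reduce rows P.phased).1, (reduce rows P.phased).2)) ?_ hpiv
    have h2 : phasedMat (2 + (reduce rows P.phased).1, (reduce rows P.phased).2) =
        -phasedMat (reduce rows P.phased) := by
      simp [phasedMat, iPow_add, iPow_two]
    rw [h2, h, P.unit_opp, neg_mul, Units.val_neg]
    rfl

theorem mem_of_reduce_eq_id (hS : IsStabiliserGroup (genGroup L)) (hT : IsTableau rows L)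
    {P : SignedPauli n} (h : (reduce rows P.phased).2 = idString n) :
    (reduce rows P.phased).1 = 0 ∧ P.unit ∈ genGroup L ∨
      (reduce rows P.phased).1 = 2 ∧ P.opp.unit ∈ genGroup L := by
  obtain ⟨U, hU, hx⟩ := exists_phasedMat_reduce rows P.phased
  rw [hT.genGroup_eq] at hU
  rw [phasedMat_phased, phasedMat, h, pauliString_id] at hx
  generalize (reduce rows P.phased).1 = k at hx
  have hUU : (U : QMat n) * U = 1 := by
    rw [← Units.val_mul, hS.mul_self hU, Units.val_one]
  have hPU : P.mat = iPow k • (U : QMat n) := by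
    have := congrArg (· * (U : QMat n)) hx
    simpa [mul_assoc, hUU] using this.symm
  have hsq : iPow (k + k) = 1 := by
    have h1 := P.mat_mul_self
    rw [hPU, smul_mul_smul_comm, hUU, ← iPow_add] at h1
    have h2 := congrArg (fun A => A (fun _ => 0) (fun _ => 0)) h1
    simpa using h2
  rcases iPow_add_self k with ⟨rfl | rfl, -⟩ | h'
  · refine Or.inl ⟨rfl, ?_⟩
    rw [iPow_zero, one_smul] at hPU
    rwa [show P.unit = U from Units.ext hPU]
  · refine Or.inr ⟨rfl, ?_⟩
    rw [iPow_two, neg_one_smul] at hPU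
    rwa [show P.opp.unit = U by rw [P.unit_opp, show P.unit = -U from Units.ext hPU, neg_neg]]
  · rw [hsq] at h'
    norm_num at h'

theorem reduce_eq_id_iff (hS : IsStabiliserGroup (genGroup L)) (hT : IsTableau rows L)
    (P : SignedPauli n) : (reduce rows P.phased).2 = idString n ↔
      P.unit ∈ genGroup L ∨ P.opp.unit ∈ genGroup L :=
  ⟨fun h => (mem_of_reduce_eq_id hS hT h).imp And.right And.right, reduce_eq_id_of_mem hS hT⟩

theorem answer_reduce (hS : IsStabiliserGroup (genGroup L)) (hT : IsTableau rows L)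
    (P : SignedPauli n) :
    answer (decide ((reduce rows P.phased).2 ≠ idString n)) (reduce rows P.phased).1 =
      label (hypothesisState L) P := by
  by_cases h : (reduce rows P.phased).2 = idString n
  · rcases mem_of_reduce_eq_id hS hT h with ⟨hk, hm⟩ | ⟨hk, hm⟩
    · rw [hypothesisState, label_of_mem hS hm, hk]
      simp [answer, h]
    · rw [hypothesisState, label_of_opp_mem hS hm, hk]
      simp only [answer, h, ne_eq, not_true_eq_false, decide_false, Bool.false_eq_true, if_false]
      rfl
  · have h' := (reduce_eq_id_iff hS hT P).not.mp h
    rw [not_or] at h'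
    rw [hypothesisState, label_of_not_mem hS h'.1 h'.2]
    simp [answer, h]

/-- The row that the machine stores for a reduced string. -/
def rowOf (x : ZMod 4 × (Fin n → PauliLetter)) : SignedPauli n := (decide (x.1 = 2), x.2)

theorem isTableau_append {P : SignedPauli n} (hS : IsStabiliserGroup (genGroup (P :: L)))
    (hT : IsTableau rows L) (hne : (reduce rows P.phased).2 ≠ idString n) :
    IsTableau (rows ++ [rowOf (reduce rows P.phased)]) (P :: L) := by
  have hle : genGroup L ≤ genGroup (P :: L) := genGroup_mono (List.subset_cons_self _ _)
  obtain ⟨U, hU, hx⟩ := exists_phasedMat_reduce rows P.phased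
  rw [phasedMat_phased] at hx
  have hU' : U ∈ genGroup L := hT.genGroup_eq ▸ hU
  have hPU : P.unit * U ∈ genGroup (P :: L) := mul_mem (unit_mem_genGroup (by simp)) (hle hU')
  have hk := hS.phase_even hPU hx.symm
  have hrow : (rowOf (reduce rows P.phased)).unit = P.unit * U := by
    ext1
    change SignedPauli.mat _ = P.mat * (U : QMat n)
    rw [← hx, SignedPauli.mat_eq, phasedMat]
    rcases hk with hk | hk <;> simp only [rowOf, hk] <;> rfl
  refine ⟨?_, by simp [hT.length_eq], ?_, ?_⟩
  · apply le_antisymm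
    · refine genGroup_le_iff.mpr fun r hr => ?_
      rcases List.mem_append.mp hr with hr | hr
      · exact hle (hT.genGroup_eq ▸ unit_mem_genGroup hr)
      · rw [List.mem_singleton.mp hr, hrow]
        exact hPU
    · have hsub : genGroup rows ≤ genGroup (rows ++ [rowOf (reduce rows P.phased)]) :=
        genGroup_mono (List.subset_append_left _ _)
      refine genGroup_cons_le_iff.mpr ⟨?_, hT.genGroup_eq ▸ hsub⟩
      rw [← Subgroup.mul_mem_cancel_right _ (hsub hU), ← hrow]
      exact unit_mem_genGroup (by simp)
  · rw [List.pairwise_append]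
    refine ⟨hT.pivots, List.pairwise_singleton _ _, fun r hr s hs => ?_⟩
    rw [List.mem_singleton.mp hs]
    exact pivot_reduce hT.pivots hT.ne_id P.phased hr
  · intro r hr
    rcases List.mem_append.mp hr with hr | hr
    · exact hT.ne_id r hr
    · rw [List.mem_singleton.mp hr]
      exact hne

/-! ### Runs of the elimination machine on Pauli operators -/

/-- The letters of a Pauli string as tokens, the last qubit first. -/
def letters (p : Fin n → PauliLetter) : List Token := (word p).map Token.letter

/-- A row as it stands on the stack of rows. -/
def rowTokens (r : SignedPauli n) : List Token := letters r.2 ++ [Token.sign r.1]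

/-- The rows as they stand on the stack of rows. -/
def rowsTokens (rows : List (SignedPauli n)) : List Token := rows.flatMap rowTokens

theorem length_letters (p : Fin n → PauliLetter) : (letters p).length = n := by
  simp [letters, length_word]

theorem length_rowsTokens (rows : List (SignedPauli n)) :
    (rowsTokens rows).length = rows.length * (n + 1) := by
  simp [rowsTokens, List.length_flatMap, rowTokens, length_letters]

theorem letters_reverse (p : Fin n → PauliLetter) :
    (letters p).reverse = List.ofFn fun i => Token.letter (p i) := by
  rw [letters, word, List.map_ofFn]
  apply List.ext_getElem
  · simp
  · intro i h1 h2
    have hi : i < n := by simpa using h2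
    simp only [List.getElem_reverse, List.getElem_ofFn, List.length_ofFn, Function.comp]
    congr 2
    ext
    simp only [Fin.val_rev]
    omega

theorem encodePauli_eq (P : SignedPauli n) :
    encodePauli P = Token.sign P.1 :: (letters P.2).reverse := by
  rw [encodePauli, letters_reverse]

theorem encodePauli_reverse (P : SignedPauli n) : (encodePauli P).reverse = rowTokens P := by
  rw [encodePauli_eq, List.reverse_cons, List.reverse_reverse, rowTokens]

theorem runs_next_pass (f : Bool) (k : ZMod 4) (r : SignedPauli n) (i o t R d v a : List Token) :
    Runs learning 1 (.next f k) (contents i o t (rowTokens r ++ R) d v a) (.pass none k)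
      (contents i o t (rowTokens r ++ R) d v a) := by
  have h : ∃ x l, rowTokens r ++ R = x :: l := by
    rcases hw : letters r.2 with _ | ⟨x, l⟩
    · exact ⟨_, _, by rw [rowTokens, hw]; rfl⟩
    · exact ⟨_, _, by rw [rowTokens, hw]; rfl⟩
  obtain ⟨x, l, h⟩ := h
  rw [h]
  exact .of_table rfl (by intro k; cases k <;> rfl)

theorem runs_back_letters (k : ZMod 4) (p : Fin n → PauliLetter) (i o t r d : List Token) :
    Runs learning (n + 1) (.back false k) (contents i o t r d [] (letters p).reverse)
      (.next (decide (p ≠ idString n)) k) (contents i o t r d (letters p) []) := by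
  have h := runs_back (learning := learning) false k (word p).reverse i o t r d []
  rw [Bool.false_or, List.any_reverse, any_word, List.length_reverse, length_word,
    List.map_reverse, List.reverse_reverse, List.append_nil] at h
  exact h

theorem runs_reduceRow (f : Bool) (x : ZMod 4 × (Fin n → PauliLetter)) (r : SignedPauli n)
    (i o t R d : List Token) :
    Runs learning (2 * n + 3) (.next f x.1)
      (contents i o t (rowTokens r ++ R) d (letters x.2) [])
      (.next (decide ((reduceRow x r).2 ≠ idString n)) (reduceRow x r).1)
      (contents i o t R ((rowTokens r).reverse ++ d) (letters (reduceRow x r).2) []) := by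
  have h1 := runs_next_pass (learning := learning) f x.1 r i o t R d (letters x.2) []
  have h2 := runs_pass (learning := learning) none x.1 (word r.2) (word x.2)
    (by rw [length_word, length_word]) r.1 i o t R d []
  have hk : (if (none : Option Bool).getD (pivotBit (word r.2) (word x.2)) = true then
      x.1 + phaseWord (word x.2) (word r.2) + signPhase r.1 else x.1) = (reduceRow x r).1 := by
    rw [phaseWord_word, Option.getD_none, reduceRow, pivot]
    split_ifs <;> rfl
  have hv : (if (none : Option Bool).getD (pivotBit (word r.2) (word x.2)) = true then
      mulWord (word x.2) (word r.2) else word x.2) = word (reduceRow x r).2 := by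
    rw [mulWord_word, Option.getD_none, reduceRow, pivot]
    split_ifs <;> rfl
  rw [hk, hv, length_word] at h2
  have h3 := runs_back_letters (learning := learning) (reduceRow x r).1 (reduceRow x r).2 i o t R
    ((rowTokens r).reverse ++ d)
  have e1 : (word r.2).map Token.letter ++ Token.sign r.1 :: R = rowTokens r ++ R := by
    simp [rowTokens, letters]
  have e2 : Token.sign r.1 :: (((word r.2).map Token.letter).reverse ++ d) =
      (rowTokens r).reverse ++ d := by
    simp [rowTokens, letters]
  rw [e1, e2, List.append_nil] at h2
  exact ((h1.trans h2).trans h3).mono (by omega)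

theorem runs_reduce (rows : List (SignedPauli n)) (x : ZMod 4 × (Fin n → PauliLetter))
    (i o t d : List Token) :
    Runs learning (rows.length * (2 * n + 3)) (.next (decide (x.2 ≠ idString n)) x.1)
      (contents i o t (rowsTokens rows) d (letters x.2) [])
      (.next (decide ((reduce rows x).2 ≠ idString n)) (reduce rows x).1)
      (contents i o t [] ((rowsTokens rows).reverse ++ d) (letters (reduce rows x).2) []) := by
  induction rows generalizing x d with
  | nil => exact (ReachIn.refl _).mono (Nat.zero_le _)
  | cons r rows ih =>
    have h := (runs_reduceRow (learning := learning) (decide (x.2 ≠ idString n)) x r i o t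
      (rowsTokens rows) d).trans (ih (reduceRow x r) ((rowTokens r).reverse ++ d))
    have e : (rowsTokens (r :: rows)).reverse ++ d =
        (rowsTokens rows).reverse ++ ((rowTokens r).reverse ++ d) := by
      simp [rowsTokens]
    rw [e]
    exact h.mono (by rw [List.length_cons]; ring_nf; omega)

theorem runs_load_reduce_true (neg : Bool) (P P' : SignedPauli n) (hP : P' = (P.1 ^^ neg, P.2))
    (rows : List (SignedPauli n)) (i o t : List Token) :
    Runs true ((n + 1) + (n + 1) + rows.length * (2 * n + 3)) (.load neg)
      (contents i o (rowTokens P ++ t) (rowsTokens rows) [] [] [])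
      (.next (decide ((reduce rows P'.phased).2 ≠ idString n)) (reduce rows P'.phased).1)
      (contents i (encodePauli P' ++ o) t [] (rowsTokens rows).reverse
        (letters (reduce rows P'.phased).2) []) := by
  have h1 := runs_load_true neg (word P.2) P.1 i o t (rowsTokens rows) [] [] []
  have e1 : (word P.2).map Token.letter ++ Token.sign P.1 :: t = rowTokens P ++ t := by
    simp [rowTokens, letters]
  have e2 : Token.sign (P.1 ^^ neg) :: (((word P.2).map Token.letter).reverse ++ o) =
      encodePauli P' ++ o := by
    rw [encodePauli_eq, hP]
    rfl
  rw [e1, e2, List.append_nil, length_word] at h1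
  have h2 := runs_back_letters (learning := true) (signPhase (P.1 ^^ neg)) P.2 i
    (encodePauli P' ++ o) t (rowsTokens rows) []
  have h3 := runs_reduce (learning := true) rows P'.phased i (encodePauli P' ++ o) t []
  rw [List.append_nil] at h3
  subst hP
  exact (h1.trans h2).trans h3

theorem runs_load_reduce_false (P : SignedPauli n) (rows : List (SignedPauli n))
    (i o t : List Token) :
    Runs false ((n + 1) + (n + 1) + rows.length * (2 * n + 3)) (.load false)
      (contents i o (rowTokens P ++ t) (rowsTokens rows) [] [] [])
      (.next (decide ((reduce rows P.phased).2 ≠ idString n)) (reduce rows P.phased).1)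
      (contents i o t [] (rowsTokens rows).reverse (letters (reduce rows P.phased).2) []) := by
  have h1 := runs_load_false false (word P.2) P.1 i o t (rowsTokens rows) [] [] []
  have e1 : (word P.2).map Token.letter ++ Token.sign P.1 :: t = rowTokens P ++ t := by
    simp [rowTokens, letters]
  rw [e1, List.append_nil, length_word, Bool.xor_false] at h1
  have h2 := runs_back_letters (learning := false) (signPhase P.1) P.2 i o t (rowsTokens rows) []
  have h3 := runs_reduce (learning := false) rows P.phased i o t []
  rw [List.append_nil] at h3
  exact (h1.trans h2).trans h3

theorem runs_next_insert (x : ZMod 4 × (Fin n → PauliLetter)) (rows : List (SignedPauli n))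
    (i o t : List Token) (ht : learning = true ∨ t ≠ []) :
    Runs learning (1 + (n + 1) + ((rows.length + 1) * (n + 1) + 1)) (.next true x.1)
      (contents i o t [] (rowsTokens rows).reverse (letters x.2) []) .main
      (contents i o t (rowsTokens (rows ++ [rowOf x])) [] [] []) := by
  have h1 : Runs learning 1 (.next true x.1)
      (contents i o t [] (rowsTokens rows).reverse (letters x.2) []) (.insert x.1)
      (contents i o t [] (rowsTokens rows).reverse (letters x.2) []) := by
    rcases ht with rfl | ht
    · exact .of_table rfl (by intro k; cases k <;> rfl)
    · rcases t with _ | ⟨y, t⟩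
      · exact absurd rfl ht
      · rcases learning with _ | _ <;> exact .of_table rfl (by intro k; cases k <;> rfl)
  have h2 := runs_insert (learning := learning) x.1 i o t [] (rowsTokens rows).reverse
    (letters x.2) []
  have e : Token.sign (decide (x.1 = 2)) :: ((letters x.2).reverse ++ (rowsTokens rows).reverse) =
      (rowsTokens (rows ++ [rowOf x])).reverse := by
    simp [rowsTokens, rowTokens, rowOf]
  rw [e, length_letters] at h2
  have h3 := runs_restore (learning := learning) i o t [] (rowsTokens (rows ++ [rowOf x])).reverse
    [] []
  rw [List.reverse_reverse, List.append_nil, List.length_reverse, length_rowsTokens,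
    List.length_append, List.length_singleton] at h3
  exact (h1.trans h2).trans h3

theorem head_encodeGens (L : List (SignedPauli n)) (c : PauliLetter) :
    (encodeGens L).head? ≠ some (.letter c) := by
  rcases L with _ | ⟨P, L⟩ <;> simp [encodeGens, encodePauli]

theorem runs_next_discard (k : ZMod 4) (p : Fin n → PauliLetter) (P : SignedPauli n)
    (rows L : List (SignedPauli n)) (i t : List Token) :
    Runs true (1 + (n + 1) + (n + 1) + (rows.length * (n + 1) + 1)) (.next false k)
      (contents i (encodePauli P ++ encodeGens L) t [] (rowsTokens rows).reverse (letters p) [])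
      .main (contents i (encodeGens L) t (rowsTokens rows) [] [] []) := by
  have h1 : Runs true 1 (.next false k)
      (contents i (encodePauli P ++ encodeGens L) t [] (rowsTokens rows).reverse (letters p) [])
      .discard
      (contents i (encodePauli P ++ encodeGens L) t [] (rowsTokens rows).reverse (letters p) []) :=
    .of_table rfl (by intro k; cases k <;> rfl)
  have h2 := runs_discard (learning := true) i (encodePauli P ++ encodeGens L) t []
    (rowsTokens rows).reverse (letters p) []
  have h3 := runs_retract (learning := true) (word P.2).reverse i (encodeGens L) t []
    (rowsTokens rows).reverse [] [] (head_encodeGens L)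
  have e : (encodePauli P ++ encodeGens L).tail =
      (word P.2).reverse.map Token.letter ++ encodeGens L := by
    rw [encodePauli_eq, List.map_reverse]
    rfl
  rw [e, length_letters] at h2
  rw [List.length_reverse, length_word] at h3
  have h4 := runs_restore (learning := true) i (encodeGens L) t [] (rowsTokens rows).reverse [] []
  rw [List.reverse_reverse, List.append_nil, List.length_reverse, length_rowsTokens] at h4
  exact ((h1.trans h2).trans h3).trans h4

/-! ### The predictor -/

theorem predictor_insert_gens (hn : 1 ≤ n) (L : List (SignedPauli n)) (hL : IndependentGens L)
    (hS : IsStabiliserGroup (genGroup L)) (t : List Token) (ht : t ≠ []) :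
    ∃ rows, IsTableau rows L ∧ Runs false (L.length * (20 * n ^ 2)) .main
      (contents [] [] ((encodeGens L).reverse ++ t) [] [] [] []) .main
      (contents [] [] t (rowsTokens rows) [] [] []) := by
  induction L generalizing t with
  | nil => exact ⟨[], isTableau_nil, by simpa [encodeGens, rowsTokens] using ReachIn.refl _⟩
  | cons P L ih =>
    have hS' := hS.mono (genGroup_mono (List.subset_cons_self P L))
    obtain ⟨rows, hT, h⟩ := ih hL.tail hS' (rowTokens P ++ t) (by simp [rowTokens])
    have hnot : ¬ (P.unit ∈ genGroup L ∨ P.opp.unit ∈ genGroup L) := by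
      rintro (h' | h')
      · exact hL.head h'
      · exact hS.not_both (unit_mem_genGroup (by simp))
          (genGroup_mono (List.subset_cons_self P L) h')
    have hne := (reduce_eq_id_iff hS' hT P).not.mpr hnot
    refine ⟨_, isTableau_append hS hT hne, ?_⟩
    have h1 : Runs false 1 .main (contents [] [] (rowTokens P ++ t) (rowsTokens rows) [] [] [])
        (.load false) (contents [] [] (rowTokens P ++ t) (rowsTokens rows) [] [] []) :=
      .of_table rfl (by intro k; cases k <;> rfl)
    have h2 := runs_load_reduce_false P rows [] [] t
    rw [decide_eq_true hne] at h2
    have h3 := runs_next_insert (learning := false) (reduce rows P.phased) rows [] [] t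
      (Or.inr ht)
    have e : (encodeGens (P :: L)).reverse ++ t = (encodeGens L).reverse ++ (rowTokens P ++ t) := by
      rw [encodeGens, List.flatMap_cons, List.reverse_append, encodePauli_reverse,
        List.append_assoc]
      rfl
    rw [e]
    refine (h.trans ((h1.trans h2).trans h3)).mono ?_
    have hlen := hL.length_le hS
    rw [hT.length_eq, List.length_cons] at *
    nlinarith

theorem length_encodePauli (P : SignedPauli n) : (encodePauli P).length = n + 1 := by
  simp [encodePauli]

theorem length_encodeGens (L : List (SignedPauli n)) :
    (encodeGens L).length = L.length * (n + 1) := by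
  simp [encodeGens, List.length_flatMap, length_encodePauli]

theorem haltsWithin_predictor (hn : 1 ≤ n) (L : List (SignedPauli n)) (hL : IndependentGens L)
    (hS : IsStabiliserGroup (genGroup L)) (P : SignedPauli n) :
    HaltsWithin (machine false) (encodePauli P ++ encodeGens L)
      [Token.outcome (label (hypothesisState L) P)] (50 * n ^ 3) := by
  have hlen := hL.length_le hS
  have h0 := runs_start (learning := false) (encodePauli P ++ encodeGens L) [] [] [] [] [] []
  obtain ⟨rows, hT, h1⟩ := predictor_insert_gens hn L hL hS (rowTokens P) (by simp [rowTokens])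
  rw [List.reverse_append, encodePauli_reverse, List.append_nil, List.length_append,
    length_encodePauli, length_encodeGens] at h0
  have h2 : Runs false 1 .main (contents [] [] (rowTokens P) (rowsTokens rows) [] [] [])
      (.load false) (contents [] [] (rowTokens P) (rowsTokens rows) [] [] []) :=
    .of_table rfl (by intro k; cases k <;> rfl)
  have h3 := runs_load_reduce_false P rows [] [] []
  rw [List.append_nil] at h3
  have h4 : Runs false 1
      (.next (decide ((reduce rows P.phased).2 ≠ idString n)) (reduce rows P.phased).1)
      (contents [] [] [] [] (rowsTokens rows).reverse (letters (reduce rows P.phased).2) []) .clean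
      (contents [] [Token.outcome (label (hypothesisState L) P)] [] [] (rowsTokens rows).reverse
        (letters (reduce rows P.phased).2) []) := by
    rw [← answer_reduce hS hT P]
    exact .of_table rfl (by intro k; cases k <;> rfl)
  have hr : (rowsTokens rows).length ≤ n * (n + 1) := by
    rw [length_rowsTokens, hT.length_eq]
    exact Nat.mul_le_mul_right _ hlen
  have h5 := runs_clean (learning := false) (n * (n + 1)) []
    [Token.outcome (label (hypothesisState L) P)] [] [] (rowsTokens rows).reverse
    (letters (reduce rows P.phased).2) [] (by simp) (by simpa using hr)
    (by rw [length_letters]; nlinarith)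
  have h := haltsWithin_machine (((((h0.trans h1).trans h2).trans h3).trans h4).trans h5)
  obtain ⟨h⟩ := h
  refine ⟨⟨h.toEvalsTo, h.steps_le_m.trans ?_⟩⟩
  rw [hT.length_eq]
  have hn2 : n ≤ n ^ 2 := by nlinarith
  have hn3 : n ^ 2 ≤ n ^ 3 := Nat.pow_le_pow_right hn (by norm_num)
  have e1 : L.length * (20 * n ^ 2) ≤ 20 * n ^ 3 := by
    calc L.length * (20 * n ^ 2) ≤ n * (20 * n ^ 2) := Nat.mul_le_mul_right _ hlen
      _ = 20 * n ^ 3 := by ring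
  have e2 : L.length * (n + 1) ≤ n ^ 2 + n := by nlinarith
  have e3 : L.length * (2 * n + 3) ≤ 2 * n ^ 2 + 3 * n := by nlinarith
  have e4 : n * (n + 1) = n ^ 2 + n := by ring
  omega

/-! ### The learner -/

open Classical in
/-- Keep a stabiliser if it is not generated by those already kept. -/
noncomputable def keepIndependent (P : SignedPauli n) (L : List (SignedPauli n)) :
    List (SignedPauli n) :=
  if P.unit ∈ genGroup L then L else P :: L

/-- The output of the learner: it goes through the revealed stabilisers, the last one first, and
keeps those that are not generated by the ones already kept. -/
noncomputable def learnedGens (T : List (SignedPauli n × Outcome)) : List (SignedPauli n) :=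
  (revealed T).foldr keepIndependent []

theorem revealed_append (T T' : List (SignedPauli n × Outcome)) :
    revealed (T ++ T') = revealed T ++ revealed T' := List.filterMap_append

theorem genGroup_keepIndependent (P : SignedPauli n) (L : List (SignedPauli n)) :
    genGroup (keepIndependent P L) = genGroup (P :: L) := by
  rw [keepIndependent]
  split_ifs with h
  · exact (genGroup_cons_of_mem h).symm
  · rfl

theorem card_keepIndependent {P : SignedPauli n} {L : List (SignedPauli n)}
    (hS : IsStabiliserGroup (genGroup (P :: L))) (hL : Nat.card (genGroup L) = 2 ^ L.length) :
    Nat.card (genGroup (keepIndependent P L)) = 2 ^ (keepIndependent P L).length := by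
  rw [keepIndependent]
  split_ifs with h
  · exact hL
  · rw [card_genGroup_cons hS h, hL, List.length_cons, pow_succ']

theorem keepIndependent_sublist {P : SignedPauli n} {L L' : List (SignedPauli n)}
    (h : L.Sublist L') : (keepIndependent P L).Sublist (P :: L') := by
  rw [keepIndependent]
  split_ifs
  · exact h.cons P
  · exact h.cons_cons P

theorem length_le_of_card {L : List (SignedPauli n)} (hS : IsStabiliserGroup (genGroup L))
    (hL : Nat.card (genGroup L) = 2 ^ L.length) : L.length ≤ n := by
  have := card_le_two_pow hS
  rw [hL] at this
  exact (Nat.pow_le_pow_iff_right (by norm_num)).mp this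

theorem learner_load (hn : 1 ≤ n) {S : Subgroup (QMat n)ˣ} (hS : IsStabiliserGroup S)
    {rows L : List (SignedPauli n)} (hLS : genGroup L ≤ S)
    (hL : Nat.card (genGroup L) = 2 ^ L.length) (hT : IsTableau rows L) (neg : Bool)
    (P P' : SignedPauli n) (hP : P' = (P.1 ^^ neg, P.2)) (hP' : P'.unit ∈ S) (t : List Token) :
    ∃ rows', IsTableau rows' (keepIndependent P' L) ∧ Runs true (19 * n ^ 2) (.load neg)
      (contents [] (encodeGens L) (rowTokens P ++ t) (rowsTokens rows) [] [] []) .main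
      (contents [] (encodeGens (keepIndependent P' L)) t (rowsTokens rows') [] [] []) := by
  have hLst := hS.mono hLS
  have hcons : IsStabiliserGroup (genGroup (P' :: L)) :=
    hS.mono (genGroup_cons_le_iff.mpr ⟨hP', hLS⟩)
  have h1 := runs_load_reduce_true neg P P' hP rows [] (encodeGens L) t
  have hiff := reduce_eq_id_iff hLst hT P'
  have hlen := length_le_of_card hLst hL
  by_cases hm : P'.unit ∈ genGroup L
  · have e : keepIndependent P' L = L := by rw [keepIndependent, if_pos hm]
    rw [e]
    refine ⟨rows, hT, ?_⟩
    rw [decide_eq_false (not_not.mpr (hiff.mpr (Or.inl hm)))] at h1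
    have h2 := runs_next_discard (reduce rows P'.phased).1 (reduce rows P'.phased).2 P' rows L [] t
    refine (h1.trans h2).mono ?_
    rw [hT.length_eq]
    nlinarith
  · have e : keepIndependent P' L = P' :: L := by rw [keepIndependent, if_neg hm]
    have hcard := card_keepIndependent hcons hL
    rw [e] at hcard ⊢
    have hlen' := length_le_of_card hcons hcard
    have hne : (reduce rows P'.phased).2 ≠ idString n := by
      rw [Ne, hiff]
      rintro (h | h)
      · exact hm h
      · exact hS.not_both hP' (hLS h)
    refine ⟨_, isTableau_append hcons hT hne, ?_⟩
    rw [decide_eq_true hne] at h1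
    have h2 := runs_next_insert (learning := true) (reduce rows P'.phased) rows []
      (encodePauli P' ++ encodeGens L) t (Or.inl rfl)
    refine (h1.trans h2).mono ?_
    rw [hT.length_eq]
    rw [List.length_cons] at hlen'
    nlinarith

theorem learner_loop (hn : 1 ≤ n) {S : Subgroup (QMat n)ˣ} (hS : IsStabiliserGroup S)
    (T : List (SignedPauli n × Outcome)) (hTS : ∀ P ∈ revealed T, P.unit ∈ S)
    {rows L : List (SignedPauli n)} (hLS : genGroup L ≤ S)
    (hL : Nat.card (genGroup L) = 2 ^ L.length) (hT : IsTableau rows L) :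
    ∃ rows', IsTableau rows' ((revealed T).foldr keepIndependent L) ∧
      Runs true (T.length * (20 * n ^ 2)) .main
        (contents [] (encodeGens L) (encodeTrainingSet T).reverse (rowsTokens rows) [] [] []) .main
        (contents [] (encodeGens ((revealed T).foldr keepIndependent L)) [] (rowsTokens rows')
          [] [] []) := by
  induction T using List.reverseRecOn generalizing rows L with
  | nil => exact ⟨rows, hT, by simpa [encodeTrainingSet, revealed] using ReachIn.refl _⟩
  | append_singleton T e ih =>
    rw [revealed_append] at hTS ⊢
    have hTS' : ∀ P ∈ revealed T, P.unit ∈ S := fun P hP => hTS P (List.mem_append_left _ hP)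
    have enc : (encodeTrainingSet (T ++ [e])).reverse =
        Token.outcome e.2 :: (rowTokens e.1 ++ (encodeTrainingSet T).reverse) := by
      simp [encodeTrainingSet, encodePauli_reverse]
    rw [enc, List.foldr_append, List.length_append, List.length_singleton]
    obtain ⟨P, o⟩ := e
    have hn2 : 1 ≤ n ^ 2 := Nat.one_le_pow _ _ hn
    have load : ∀ (neg : Bool) (P' : SignedPauli n), P' = (P.1 ^^ neg, P.2) →
        revealed [(P, o)] = [P'] →
        Runs true 1 .main
          (contents [] (encodeGens L) (Token.outcome o :: (rowTokens P ++
            (encodeTrainingSet T).reverse)) (rowsTokens rows) [] [] []) (.load neg)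
          (contents [] (encodeGens L) (rowTokens P ++ (encodeTrainingSet T).reverse)
            (rowsTokens rows) [] [] []) →
        ∃ rows', IsTableau rows' ((revealed T).foldr keepIndependent
            ((revealed [(P, o)]).foldr keepIndependent L)) ∧
          Runs true ((T.length + 1) * (20 * n ^ 2)) .main
            (contents [] (encodeGens L) (Token.outcome o :: (rowTokens P ++
              (encodeTrainingSet T).reverse)) (rowsTokens rows) [] [] []) .main
            (contents [] (encodeGens ((revealed T).foldr keepIndependent
              ((revealed [(P, o)]).foldr keepIndependent L))) [] (rowsTokens rows') [] [] []) := by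
      intro neg P' hP hrev hstep
      have hP' : P'.unit ∈ S := hTS P' (List.mem_append_right _ (by rw [hrev]; simp))
      have hcons : genGroup (P' :: L) ≤ S := genGroup_cons_le_iff.mpr ⟨hP', hLS⟩
      obtain ⟨rows1, hT1, h1⟩ := learner_load hn hS hLS hL hT neg P P' hP hP'
        (encodeTrainingSet T).reverse
      rw [hrev]
      obtain ⟨rows2, hT2, h2⟩ := ih hTS' (L := keepIndependent P' L)
        (by rw [genGroup_keepIndependent]; exact hcons)
        (card_keepIndependent (hS.mono hcons) hL) hT1
      exact ⟨rows2, hT2, ((hstep.trans h1).trans h2).mono (by nlinarith)⟩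
    cases o with
    | one => exact load false P (by simp) rfl (.of_table rfl (by intro k; cases k <;> rfl))
    | zero =>
      exact load true P.opp (by simp [SignedPauli.opp]) rfl
        (.of_table rfl (by intro k; cases k <;> rfl))
    | half =>
      obtain ⟨rows', hT', h'⟩ := ih hTS' hLS hL hT
      refine ⟨rows', hT', ?_⟩
      have h1 : Runs true 1 .main
          (contents [] (encodeGens L) (Token.outcome .half :: (rowTokens P ++
            (encodeTrainingSet T).reverse)) (rowsTokens rows) [] [] []) .skip
          (contents [] (encodeGens L) (rowTokens P ++ (encodeTrainingSet T).reverse)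
            (rowsTokens rows) [] [] []) := .of_table rfl (by intro k; cases k <;> rfl)
      have h2 := runs_skip (learning := true) (word P.2) P.1 [] (encodeGens L)
        (encodeTrainingSet T).reverse (rowsTokens rows) [] [] []
      have e1 : (word P.2).map Token.letter ++ Token.sign P.1 :: (encodeTrainingSet T).reverse =
          rowTokens P ++ (encodeTrainingSet T).reverse := by
        simp [rowTokens, letters]
      rw [e1, length_word] at h2
      exact ((h1.trans h2).trans h').mono (by nlinarith)

theorem learnedGens_sublist (T : List (SignedPauli n × Outcome)) :
    (learnedGens T).Sublist (revealed T) := by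
  rw [learnedGens]
  induction revealed T with
  | nil => exact List.Sublist.refl _
  | cons P L ih => exact keepIndependent_sublist ih

theorem genGroup_learnedGens (T : List (SignedPauli n × Outcome)) :
    genGroup (learnedGens T) = genGroup (revealed T) := by
  rw [learnedGens]
  induction revealed T with
  | nil => rfl
  | cons P L ih =>
    rw [List.foldr_cons, genGroup_keepIndependent]
    exact genGroup_cons_congr P ih

theorem card_learnedGens {T : List (SignedPauli n × Outcome)}
    (hS : IsStabiliserGroup (genGroup (revealed T))) :
    Nat.card (genGroup (learnedGens T)) = 2 ^ (learnedGens T).length := by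
  rw [← genGroup_learnedGens] at hS
  rw [learnedGens] at hS ⊢
  generalize revealed T = l at hS ⊢
  induction l with
  | nil => simp [genGroup_nil]
  | cons P L ih =>
    rw [List.foldr_cons, genGroup_keepIndependent] at hS
    exact card_keepIndependent hS (ih (hS.mono (genGroup_mono (List.subset_cons_self _ _))))

theorem haltsWithin_learner (hn : 1 ≤ n) {S : Subgroup (QMat n)ˣ} (hS : IsStabiliserGroup S)
    (T : List (SignedPauli n × Outcome)) (hTS : ∀ P ∈ revealed T, P.unit ∈ S) :
    HaltsWithin (machine true) (encodeTrainingSet T) (encodeGens (learnedGens T))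
      (50 * (T.length + 1) * n ^ 3) := by
  have h0 := runs_start (learning := true) (encodeTrainingSet T) [] [] [] [] [] []
  have hbot : IsStabiliserGroup (genGroup ([] : List (SignedPauli n))) :=
    hS.mono (by rw [genGroup_nil]; exact bot_le)
  obtain ⟨rows, hT, h1⟩ := learner_loop hn hS T hTS (L := [])
    (by rw [genGroup_nil]; exact bot_le) (by simp [genGroup_nil]) isTableau_nil
  have h2 : Runs true 1 .main
      (contents [] (encodeGens (learnedGens T)) [] (rowsTokens rows) [] [] []) .clean
      (contents [] (encodeGens (learnedGens T)) [] (rowsTokens rows) [] [] []) :=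
    .of_table rfl (by intro k; cases k <;> rfl)
  have hst : IsStabiliserGroup (genGroup (revealed T)) := hS.mono (genGroup_le_iff.mpr hTS)
  have hlen := length_le_of_card (by rw [genGroup_learnedGens]; exact hst) (card_learnedGens hst)
  have hr : (rowsTokens rows).length ≤ n * (n + 1) := by
    rw [length_rowsTokens, hT.length_eq]
    exact Nat.mul_le_mul_right _ hlen
  have h3 := runs_clean (learning := true) (n * (n + 1)) [] (encodeGens (learnedGens T)) []
    (rowsTokens rows) [] [] [] hr (by simp) (by simp)
  have hinp : (encodeTrainingSet T).length = T.length * (n + 2) := by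
    simp [encodeTrainingSet, List.length_flatMap, length_encodePauli]
  rw [List.append_nil, hinp] at h0
  obtain ⟨h⟩ := haltsWithin_machine (((h0.trans h1).trans h2).trans h3)
  refine ⟨⟨h.toEvalsTo, h.steps_le_m.trans ?_⟩⟩
  have hn2 : n ≤ n ^ 2 := by nlinarith
  have hn3 : n ^ 2 ≤ n ^ 3 := Nat.pow_le_pow_right hn (by norm_num)
  have e1 : T.length * (20 * n ^ 2) ≤ 20 * (T.length * n ^ 3) := by nlinarith
  have e2 : T.length * (n + 2) ≤ 3 * (T.length * n ^ 3) := by nlinarith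
  have e4 : n * (n + 1) = n ^ 2 + n := by ring
  have e5 : 50 * (T.length + 1) * n ^ 3 = 50 * (T.length * n ^ 3) + 50 * n ^ 3 := by ring
  omega

/-! ### What a training set reveals -/

theorem revealed_cons_one (P : SignedPauli n) (T : List (SignedPauli n × Outcome)) :
    revealed ((P, .one) :: T) = P :: revealed T := rfl

theorem revealed_cons_zero (P : SignedPauli n) (T : List (SignedPauli n × Outcome)) :
    revealed ((P, .zero) :: T) = P.opp :: revealed T := rfl

variable {S : Subgroup (QMat n)ˣ}

theorem unit_mem_of_mem_revealed (hS : IsStabiliserGroup S) {m : ℕ} (x : Fin m → SignedPauli n)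
    {P : SignedPauli n} (hP : P ∈ revealed (trainingSet (stabState S) x)) : P.unit ∈ S := by
  rw [revealed, List.mem_filterMap] at hP
  obtain ⟨e, he, h⟩ := hP
  rw [trainingSet, List.mem_ofFn] at he
  obtain ⟨i, rfl⟩ := he
  rcases ho : label (stabState S) (x i) with _ | _ | _
  · simp only [ho, Option.some.injEq] at h
    exact h ▸ (label_eq_zero_iff hS).mp ho
  · simp [ho] at h
  · simp only [ho, Option.some.injEq] at h
    exact h ▸ (label_eq_one_iff hS).mp ho

theorem genGroup_revealed_le (hS : IsStabiliserGroup S) {m : ℕ} (x : Fin m → SignedPauli n) :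
    genGroup (revealed (trainingSet (stabState S) x)) ≤ S :=
  genGroup_le_iff.mpr fun _ hP => unit_mem_of_mem_revealed hS x hP

theorem mem_revealed_of_label {m : ℕ} {ρ : QMat n} (x : Fin m → SignedPauli n) (i : Fin m) :
    (label ρ (x i) = .one → x i ∈ revealed (trainingSet ρ x)) ∧
      (label ρ (x i) = .zero → (x i).opp ∈ revealed (trainingSet ρ x)) := by
  have hi : (x i, label ρ (x i)) ∈ trainingSet ρ x := by
    rw [trainingSet, List.mem_ofFn]
    exact ⟨i, rfl⟩
  constructor <;> intro h <;> rw [revealed, List.mem_filterMap] <;>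
    exact ⟨_, hi, by simp only [h]⟩

theorem concept_eq_of_mem {G : Subgroup (QMat n)ˣ} (hS : IsStabiliserGroup S) (hG : G ≤ S)
    {P : SignedPauli n} (hP : P.unit ∈ G ∨ P.opp.unit ∈ G) :
    concept (stabState G) P = concept (stabState S) P := by
  have hGst := hS.mono hG
  rcases hP with h | h
  · rw [concept_of_mem hGst h, concept_of_mem hS (hG h)]
  · rw [concept_of_opp_mem hGst h, concept_of_opp_mem hS (hG h)]

theorem concept_sample_eq (hS : IsStabiliserGroup S) {m : ℕ} (x : Fin m → SignedPauli n)
    (i : Fin m) :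
    concept (stabState (genGroup (revealed (trainingSet (stabState S) x)))) (x i) =
      concept (stabState S) (x i) := by
  have hG := genGroup_revealed_le hS x
  have hrev := mem_revealed_of_label (ρ := stabState S) x i
  by_cases h : (x i).unit ∈ S
  · exact concept_eq_of_mem hS hG (Or.inl (unit_mem_genGroup (hrev.1 (label_of_mem hS h))))
  · by_cases h' : (x i).opp.unit ∈ S
    · exact concept_eq_of_mem hS hG (Or.inr (unit_mem_genGroup (hrev.2 (label_of_opp_mem hS h'))))
    · rw [concept_of_not_mem hS h h', concept_of_not_mem (hS.mono hG) (fun h1 => h (hG h1))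
        (fun h1 => h' (hG h1))]

/-- The measurements on which the states of the groups `G ≤ S` differ. -/
def errorSet (S G : Subgroup (QMat n)ˣ) : Set (SignedPauli n) :=
  {P | (P.unit ∈ S ∨ P.opp.unit ∈ S) ∧ P.unit ∉ G ∧ P.opp.unit ∉ G}

theorem mem_errorSet_of_concept_ne {G : Subgroup (QMat n)ˣ} (hS : IsStabiliserGroup S) (hG : G ≤ S)
    {P : SignedPauli n} (h : concept (stabState G) P ≠ concept (stabState S) P) :
    P ∈ errorSet S G := by
  have hG' : ¬ (P.unit ∈ G ∨ P.opp.unit ∈ G) := fun h' => h (concept_eq_of_mem hS hG h')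
  rw [not_or] at hG'
  refine ⟨?_, hG'⟩
  by_contra hS'
  rw [not_or] at hS'
  rw [concept_of_not_mem hS hS'.1 hS'.2, concept_of_not_mem (hS.mono hG) hG'.1 hG'.2] at h
  exact h rfl

theorem abs_concept_sub_le {G : Subgroup (QMat n)ˣ} (hS : IsStabiliserGroup S) (hG : G ≤ S)
    (P : SignedPauli n) : |concept (stabState G) P - concept (stabState S) P| ≤ 1 / 2 := by
  by_cases h : concept (stabState G) P = concept (stabState S) P
  · rw [h, sub_self, abs_zero]
    norm_num
  · obtain ⟨h1, h2, h3⟩ := mem_errorSet_of_concept_ne hS hG h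
    rw [concept_of_not_mem (hS.mono hG) h2 h3]
    rcases h1 with h1 | h1
    · rw [concept_of_mem hS h1]
      norm_num [abs_le]
    · rw [concept_of_opp_mem hS h1]
      norm_num [abs_le]

/-! ### Independent samples -/

section Probability

variable {α : Type} (D : PMF α)

theorem prob_empty : prob D (∅ : Set α) = 0 := by simp [prob]

/-- The probability of a sample. -/
noncomputable def sampleWeight {m : ℕ} (x : Fin m → α) : ℝ := ∏ i, (D (x i)).toReal

theorem sampleWeight_nonneg {m : ℕ} (x : Fin m → α) : 0 ≤ sampleWeight D x :=
  Finset.prod_nonneg fun _ _ => ENNReal.toReal_nonneg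

variable [Fintype α]

open Classical in
theorem prob_eq_sum (A : Set α) : prob D A = ∑ a, if a ∈ A then (D a).toReal else 0 := by
  rw [prob, PMF.toOuterMeasure_apply_fintype, ENNReal.toReal_sum]
  · refine Finset.sum_congr rfl fun a _ => ?_
    by_cases h : a ∈ A <;> simp [h]
  · intro a _
    by_cases h : a ∈ A <;> simp [h, D.apply_ne_top]

theorem sum_toReal_eq_one : ∑ a, (D a).toReal = 1 := by
  rw [← ENNReal.toReal_sum fun a _ => D.apply_ne_top a, ← tsum_fintype (L := .unconditional α),
    D.tsum_coe, ENNReal.toReal_one]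

theorem prob_mono {A B : Set α} (h : A ⊆ B) : prob D A ≤ prob D B := by
  classical
  rw [prob_eq_sum, prob_eq_sum]
  refine Finset.sum_le_sum fun a _ => ?_
  by_cases hA : a ∈ A
  · rw [if_pos hA, if_pos (h hA)]
  · rw [if_neg hA]
    split_ifs
    · exact ENNReal.toReal_nonneg
    · exact le_rfl

theorem prob_le_one (A : Set α) : prob D A ≤ 1 := by
  classical
  rw [prob_eq_sum, ← sum_toReal_eq_one D]
  refine Finset.sum_le_sum fun a _ => ?_
  split_ifs
  · exact le_rfl
  · exact ENNReal.toReal_nonneg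

theorem sum_sampleWeight (m : ℕ) : ∑ x : Fin m → α, sampleWeight D x = 1 := by
  classical
  have h := Finset.prod_univ_sum (fun _ : Fin m => (Finset.univ : Finset α))
    (fun _ a => (D a).toReal)
  rw [Fintype.piFinset_univ] at h
  simp only [sampleWeight]
  rw [← h]
  simp [sum_toReal_eq_one]

theorem sum_sampleWeight_succ {m : ℕ} (f : (Fin (m + 1) → α) → ℝ) :
    ∑ x, sampleWeight D x * f x =
      ∑ x : Fin m → α, sampleWeight D x * ∑ a, (D a).toReal * f (Fin.cons a x) := by
  rw [← (Fin.consEquiv fun _ : Fin (m + 1) => α).sum_comp, Fintype.sum_prod_type, Finset.sum_comm]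
  refine Finset.sum_congr rfl fun x _ => ?_
  rw [Finset.mul_sum]
  refine Finset.sum_congr rfl fun a _ => ?_
  rw [sampleWeight, sampleWeight, Fin.prod_univ_succ]
  simp [Fin.consEquiv]
  ring

theorem sampleProb_univ (m : ℕ) (A : Set (Fin m → α)) (hA : ∀ x, x ∈ A) : sampleProb D m A = 1 := by
  rw [sampleProb, ← sum_sampleWeight D m]
  exact Finset.sum_congr rfl fun x _ => if_pos (hA x)

theorem sampleProb_nonneg (m : ℕ) (A : Set (Fin m → α)) : 0 ≤ sampleProb D m A := by
  refine Finset.sum_nonneg fun x _ => ?_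
  split_ifs
  · exact sampleWeight_nonneg D x
  · exact le_rfl

open Classical in
theorem one_sub_le_sampleProb (m : ℕ) (A : Set (Fin m → α)) (B : (Fin m → α) → Prop)
    (h : ∀ x, ¬ B x → x ∈ A) :
    1 - ∑ x, sampleWeight D x * (if B x then 1 else 0) ≤ sampleProb D m A := by
  have h1 : 1 - ∑ x : Fin m → α, sampleWeight D x * (if B x then 1 else 0) =
      ∑ x : Fin m → α, (sampleWeight D x - sampleWeight D x * (if B x then 1 else 0)) := by
    rw [Finset.sum_sub_distrib, sum_sampleWeight]
  rw [h1, sampleProb]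
  refine Finset.sum_le_sum fun x _ => ?_
  have hw := sampleWeight_nonneg D x
  by_cases hB : B x
  · rw [if_pos hB, mul_one, sub_self]
    split_ifs
    · exact hw
    · exact le_rfl
  · rw [if_neg hB, mul_zero, sub_zero, if_pos (h x hB)]
    exact le_rfl

end Probability

/-! ### Generalisation -/

/-- The group revealed by a sample. -/
noncomputable def sampleGroup (S : Subgroup (QMat n)ˣ) {m : ℕ} (x : Fin m → SignedPauli n) :
    Subgroup (QMat n)ˣ :=
  genGroup (revealed (trainingSet (stabState S) x))

theorem sampleGroup_cons (S : Subgroup (QMat n)ˣ) {m : ℕ} (a : SignedPauli n)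
    (x : Fin m → SignedPauli n) : sampleGroup S (Fin.cons a x : Fin (m + 1) → SignedPauli n) =
      genGroup (revealed ((a, label (stabState S) a) :: trainingSet (stabState S) x)) := by
  rw [sampleGroup, trainingSet, List.ofFn_succ]
  rfl

theorem sampleGroup_le_cons (S : Subgroup (QMat n)ˣ) {m : ℕ} (a : SignedPauli n)
    (x : Fin m → SignedPauli n) :
    sampleGroup S x ≤ sampleGroup S (Fin.cons a x : Fin (m + 1) → SignedPauli n) := by
  rw [sampleGroup_cons]
  cases label (stabState S) a
  · rw [revealed_cons_zero]
    exact genGroup_mono (List.subset_cons_self _ _)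
  · exact le_rfl
  · rw [revealed_cons_one]
    exact genGroup_mono (List.subset_cons_self _ _)

theorem card_sampleGroup_cons (hS : IsStabiliserGroup S) {m : ℕ} (a : SignedPauli n)
    (x : Fin m → SignedPauli n) (ha : a ∈ errorSet S (sampleGroup S x)) :
    Nat.card (sampleGroup S (Fin.cons a x : Fin (m + 1) → SignedPauli n)) =
      2 * Nat.card (sampleGroup S x) := by
  have hst := hS.mono (genGroup_revealed_le hS (Fin.cons a x : Fin (m + 1) → SignedPauli n))
  change IsStabiliserGroup (sampleGroup S _) at hst
  rw [sampleGroup_cons] at hst ⊢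
  obtain ⟨h1 | h1, h2, h3⟩ := ha
  · rw [label_of_mem hS h1, revealed_cons_one] at hst ⊢
    exact card_genGroup_cons hst h2
  · rw [label_of_opp_mem hS h1, revealed_cons_zero] at hst ⊢
    exact card_genGroup_cons hst h3

theorem errorSet_anti {G G' : Subgroup (QMat n)ˣ} (h : G ≤ G') : errorSet S G' ⊆ errorSet S G :=
  fun _ hP => ⟨hP.1, fun h1 => hP.2.1 (h h1), fun h1 => hP.2.2 (h h1)⟩

/-- The potential of a sample: the inverse of the order of the revealed group as long as the
error is larger than `ε`. -/
noncomputable def potential (S : Subgroup (QMat n)ˣ) (D : PMF (SignedPauli n)) (ε : ℝ) {m : ℕ}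
    (x : Fin m → SignedPauli n) : ℝ :=
  open Classical in
  if ε < prob D (errorSet S (sampleGroup S x)) then (Nat.card (sampleGroup S x) : ℝ)⁻¹ else 0

theorem potential_step (hS : IsStabiliserGroup S) (D : PMF (SignedPauli n)) (ε : ℝ) {m : ℕ}
    (x : Fin m → SignedPauli n) :
    ∑ a, (D a).toReal * potential S D ε (Fin.cons a x : Fin (m + 1) → SignedPauli n) ≤
      (1 - ε / 2) * potential S D ε x := by
  classical
  have hmono : ∀ a, prob D (errorSet S (sampleGroup S
      (Fin.cons a x : Fin (m + 1) → SignedPauli n))) ≤ prob D (errorSet S (sampleGroup S x)) :=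
    fun a => prob_mono D (errorSet_anti (sampleGroup_le_cons S a x))
  by_cases hx : ε < prob D (errorSet S (sampleGroup S x))
  · set c : ℝ := (Nat.card (sampleGroup S x) : ℝ)⁻¹ with hc
    have hc0 : 0 ≤ c := by positivity
    have hpx : potential S D ε x = c := if_pos hx
    have hbound : ∀ a, (D a).toReal *
        potential S D ε (Fin.cons a x : Fin (m + 1) → SignedPauli n) ≤
        c * (D a).toReal - c / 2 * (if a ∈ errorSet S (sampleGroup S x) then (D a).toReal else 0) := by
      intro a
      have hD : 0 ≤ (D a).toReal := ENNReal.toReal_nonneg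
      by_cases ha : a ∈ errorSet S (sampleGroup S x)
      · have : potential S D ε (Fin.cons a x : Fin (m + 1) → SignedPauli n) ≤ c / 2 := by
          rw [potential]
          split_ifs
          · rw [card_sampleGroup_cons hS a x ha, Nat.cast_mul, mul_inv, hc]
            norm_num
            linarith
          · positivity
        rw [if_pos ha]
        nlinarith [mul_le_mul_of_nonneg_left this hD]
      · have : potential S D ε (Fin.cons a x : Fin (m + 1) → SignedPauli n) ≤ c := by
          rw [potential]
          split_ifs
          · have hst := hS.mono (genGroup_revealed_le hS x)
            have hst' := hS.mono
              (genGroup_revealed_le hS (Fin.cons a x : Fin (m + 1) → SignedPauli n))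
            have hpos : 0 < Nat.card (sampleGroup S x) := card_pos_of_stabiliser hst
            have hle : Nat.card (sampleGroup S x) ≤
                Nat.card (sampleGroup S (Fin.cons a x : Fin (m + 1) → SignedPauli n)) :=
              Set.ncard_le_ncard (sampleGroup_le_cons S a x) hst'.finite
            rw [hc]
            exact inv_anti₀ (by exact_mod_cast hpos) (by exact_mod_cast hle)
          · exact hc0
        rw [if_neg ha]
        nlinarith [mul_le_mul_of_nonneg_left this hD]
    refine (Finset.sum_le_sum fun a _ => hbound a).trans ?_
    rw [Finset.sum_sub_distrib, ← Finset.mul_sum, ← Finset.mul_sum, sum_toReal_eq_one,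
      ← prob_eq_sum, hpx]
    nlinarith
  · have h0 : ∀ a, potential S D ε (Fin.cons a x : Fin (m + 1) → SignedPauli n) = 0 :=
      fun a => if_neg fun h => hx (h.trans_le (hmono a))
    have h1 : potential S D ε x = 0 := if_neg hx
    simp [h0, h1]

theorem sum_potential_le (hS : IsStabiliserGroup S) (D : PMF (SignedPauli n)) {ε : ℝ} (hε : ε ≤ 1)
    (m : ℕ) : ∑ x : Fin m → SignedPauli n, sampleWeight D x * potential S D ε x ≤
      (1 - ε / 2) ^ m := by
  induction m with
  | zero =>
    have : ∀ x : Fin 0 → SignedPauli n, potential S D ε x ≤ 1 := fun x => by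
      rw [potential]
      split_ifs
      · exact Nat.cast_inv_le_one _
      · exact zero_le_one
    simpa [sampleWeight] using this _
  | succ m ih =>
    rw [sum_sampleWeight_succ, pow_succ']
    calc _ ≤ ∑ x : Fin m → SignedPauli n, sampleWeight D x * ((1 - ε / 2) * potential S D ε x) :=
          Finset.sum_le_sum fun x _ =>
            mul_le_mul_of_nonneg_left (potential_step hS D ε x) (sampleWeight_nonneg D x)
      _ = (1 - ε / 2) * ∑ x : Fin m → SignedPauli n, sampleWeight D x * potential S D ε x := by
          rw [Finset.mul_sum]
          exact Finset.sum_congr rfl fun x _ => by ring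
      _ ≤ _ := mul_le_mul_of_nonneg_left ih (by linarith)

open Classical in
theorem sum_bad_le (hS : IsStabiliserGroup S) (D : PMF (SignedPauli n)) {ε : ℝ} (hε : ε ≤ 1)
    (m : ℕ) : ∑ x : Fin m → SignedPauli n, sampleWeight D x *
      (if ε < prob D (errorSet S (sampleGroup S x)) then 1 else 0) ≤ 2 ^ n * (1 - ε / 2) ^ m := by
  refine le_trans ?_ (mul_le_mul_of_nonneg_left (sum_potential_le hS D hε m) (by positivity))
  rw [Finset.mul_sum]
  refine Finset.sum_le_sum fun x _ => ?_
  rw [mul_left_comm]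
  refine mul_le_mul_of_nonneg_left ?_ (sampleWeight_nonneg D x)
  rw [potential]
  split_ifs
  · have hst := hS.mono (genGroup_revealed_le hS x)
    have hpos : 0 < Nat.card (sampleGroup S x) := card_pos_of_stabiliser hst
    have hle : Nat.card (sampleGroup S x) ≤ 2 ^ n := card_le_two_pow hst
    have hpos' : (0 : ℝ) < Nat.card (sampleGroup S x) := by exact_mod_cast hpos
    rw [← div_eq_mul_inv, one_le_div hpos']
    exact_mod_cast hle
  · simp

/-! ### The sample size -/

theorem two_pow_mul_le_of_sampleBound_le {n m : ℕ} {ε γ δ : ℝ} (hε : 0 < ε) (hε1 : ε < 1)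
    (hγ : 0 < γ) (hγ1 : γ < 1 / 2) (hδ : 0 < δ) (hδ1 : δ < 1) (hm : sampleBound 1 n ε γ δ ≤ m) :
    (2 : ℝ) ^ n * (1 - ε / 2) ^ m ≤ δ := by
  have hlog2 : (1 / 2 : ℝ) < Real.log 2 := by linarith [Real.log_two_gt_d9]
  have hlogδ : 0 < Real.log (1 / δ) := Real.log_pos (by rw [lt_div_iff₀ hδ]; linarith)
  have hγε : 0 < γ * ε := mul_pos hγ hε
  have hγε1 : γ * ε ≤ 1 / 2 := by nlinarith
  have hl : Real.log 2 ≤ Real.log (1 / (γ * ε)) := by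
    refine Real.log_le_log two_pos ?_
    rw [le_div_iff₀ hγε]
    linarith
  have hsq : γ ^ 2 * ε ^ 2 ≤ ε / 4 := by
    have h1 : γ ^ 2 ≤ 1 / 4 := by nlinarith
    have h2 : ε ^ 2 ≤ ε := by nlinarith
    nlinarith [sq_nonneg γ, sq_nonneg ε]
  have hpos : 0 < γ ^ 2 * ε ^ 2 := by positivity
  have h4 : 4 ≤ ε * (1 / (γ ^ 2 * ε ^ 2)) := by
    rw [mul_one_div, le_div_iff₀ hpos]
    linarith
  have h4' : 4 ≤ 1 / (γ ^ 2 * ε ^ 2) := by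
    rw [le_div_iff₀ hpos]
    nlinarith
  have hn0 : (0 : ℝ) ≤ n := Nat.cast_nonneg n
  have hmain : (n : ℝ) * Real.log 2 + Real.log (1 / δ) ≤ ε / 2 * m := by
    have hA : (n : ℝ) * Real.log 2 ≤
        (n : ℝ) / (γ ^ 2 * ε ^ 2) * Real.log (1 / (γ * ε)) ^ 2 := by
      rw [div_eq_mul_one_div, mul_assoc]
      refine mul_le_mul_of_nonneg_left ?_ hn0
      nlinarith
    have hB : (n : ℝ) * Real.log 2 + Real.log (1 / δ) ≤
        (n : ℝ) / (γ ^ 2 * ε ^ 2) * Real.log (1 / (γ * ε)) ^ 2 + Real.log (1 / δ) := by linarith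
    have hB0 : 0 ≤ (n : ℝ) * Real.log 2 + Real.log (1 / δ) := by positivity
    rw [sampleBound] at hm
    have h1 := mul_le_mul_of_nonneg_left hm hε.le
    rw [← mul_assoc] at h1
    have h2 := mul_le_mul h4 hB hB0 (by linarith)
    linarith
  have h1 : (1 - ε / 2) ^ m ≤ Real.exp (-(ε / 2) * m) := by
    have : 1 - ε / 2 ≤ Real.exp (-(ε / 2)) := by linarith [Real.add_one_le_exp (-(ε / 2))]
    rw [mul_comm, Real.exp_nat_mul]
    exact pow_le_pow_left₀ (by linarith) this m
  have h2 : (2 : ℝ) ^ n = Real.exp (n * Real.log 2) := by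
    rw [Real.exp_nat_mul, Real.exp_log two_pos]
  calc (2 : ℝ) ^ n * (1 - ε / 2) ^ m
      ≤ Real.exp (n * Real.log 2) * Real.exp (-(ε / 2) * m) := by
        rw [h2]
        exact mul_le_mul_of_nonneg_left h1 (Real.exp_pos _).le
    _ = Real.exp (n * Real.log 2 + -(ε / 2) * m) := (Real.exp_add _ _).symm
    _ ≤ Real.exp (Real.log δ) := by
        refine Real.exp_le_exp.mpr ?_
        rw [one_div, Real.log_inv] at hmain
        linarith
    _ = δ := Real.exp_log hδ

theorem generalisation (hS : IsStabiliserGroup S) (D : PMF (SignedPauli n)) {ε γ δ : ℝ}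
    (hε : 0 < ε) (hγ : 0 < γ) (hδ : 0 < δ) (m : ℕ) (hm : sampleBound 1 n ε γ δ ≤ m) :
    1 - δ ≤ sampleProb D m {x | prob D {P | γ <
      |concept (hypothesisState (learnedGens (trainingSet (stabState S) x))) P -
        concept (stabState S) P|} ≤ ε} := by
  classical
  have hhyp : ∀ x : Fin m → SignedPauli n,
      hypothesisState (learnedGens (trainingSet (stabState S) x)) = stabState (sampleGroup S x) :=
    fun x => by rw [hypothesisState, genGroup_learnedGens, sampleGroup]
  simp only [hhyp]
  rcases le_or_gt 1 δ with hδ1 | hδ1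
  · exact (by linarith : 1 - δ ≤ 0).trans (sampleProb_nonneg D m _)
  rcases le_or_gt 1 ε with hε1 | hε1
  · refine le_of_le_of_eq (by linarith) (sampleProb_univ D m _ fun x => ?_).symm
    exact (prob_le_one D _).trans hε1
  rcases le_or_gt (1 / 2) γ with hγ1 | hγ1
  · refine le_of_le_of_eq (by linarith) (sampleProb_univ D m _ fun x => ?_).symm
    · have h : {P | γ < |concept (stabState (sampleGroup S x)) P - concept (stabState S) P|} = ∅ :=
        Set.eq_empty_of_forall_notMem fun P (hP : γ < _) =>
          absurd (hP.trans_le (abs_concept_sub_le hS (genGroup_revealed_le hS x) P)) (not_lt.mpr hγ1)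
      rw [Set.mem_ofPred_eq, h, prob_empty]
      exact hε.le
  refine le_trans ?_ (one_sub_le_sampleProb D m _
    (fun x => ε < prob D (errorSet S (sampleGroup S x))) fun x hx => ?_)
  · have h1 := sum_bad_le hS D hε1.le m
    have h2 := two_pow_mul_le_of_sampleBound_le hε hε1 hγ hγ1 hδ hδ1 hm
    linarith
  · refine le_trans (prob_mono D fun P (hP : γ < _) => ?_) (not_lt.mp hx)
    refine mem_errorSet_of_concept_ne hS (genGroup_revealed_le hS x) fun h => ?_
    change concept (stabState (sampleGroup S x)) P = _ at h
    rw [h, sub_self, abs_zero] at hP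
    linarith

theorem running_time_le {n : ℕ} (hn : 1 ≤ n) {ε γ δ : ℝ} (hε : 0 < ε) (hε1 : ε < 1) (hγ : 0 < γ)
    (hγ1 : γ < 1) (hδ : 0 < δ) (hδ1 : δ < 1) (C : ℕ) :
    ((C * (⌈sampleBound 1 n ε γ δ⌉₊ + 1) * n ^ 3 : ℕ) : ℝ) ≤
      4 * C * ((n : ℝ) / (ε * γ * δ)) ^ 10 := by
  have hγε : 0 < γ * ε := mul_pos hγ hε
  set u : ℝ := 1 / (γ * ε) with hu
  set v : ℝ := 1 / δ with hv
  have hu1 : 1 ≤ u := by rw [hu, le_div_iff₀ hγε]; nlinarith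
  have hv1 : 1 ≤ v := by rw [hv, le_div_iff₀ hδ]; linarith
  have hn1 : (1 : ℝ) ≤ n := by exact_mod_cast hn
  have hy : (n : ℝ) / (ε * γ * δ) = n * (u * v) := by
    rw [hu, hv]; field_simp
  rw [hy]
  set y : ℝ := n * (u * v) with hydef
  have huv : 1 ≤ u * v := one_le_mul_of_one_le_of_one_le hu1 hv1
  have hny : (n : ℝ) ≤ y := le_mul_of_one_le_right (by linarith) huv
  have huy : u ≤ y := by
    have : u ≤ u * v := le_mul_of_one_le_right (by linarith) hv1
    exact this.trans (le_mul_of_one_le_left (by linarith) hn1)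
  have hvy : v ≤ y := by
    have : v ≤ u * v := le_mul_of_one_le_left (by linarith) hu1
    exact this.trans (le_mul_of_one_le_left (by linarith) hn1)
  have hy1 : 1 ≤ y := hn1.trans hny
  have hlu0 : 0 ≤ Real.log u := Real.log_nonneg hu1
  have hlu : Real.log u ≤ u := (Real.log_le_sub_one_of_pos (by linarith)).trans (by linarith)
  have hlv0 : 0 ≤ Real.log v := Real.log_nonneg hv1
  have hlv : Real.log v ≤ v := (Real.log_le_sub_one_of_pos (by linarith)).trans (by linarith)
  have hN : sampleBound 1 n ε γ δ = u ^ 2 * (n * u ^ 2 * Real.log u ^ 2 + Real.log v) := by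
    rw [sampleBound, ← hu, ← hv]
    have : u ^ 2 = 1 / (γ ^ 2 * ε ^ 2) := by rw [hu]; field_simp
    rw [this]
    ring
  have hN0 : 0 ≤ sampleBound 1 n ε γ δ := by rw [hN]; positivity
  have hN1 : sampleBound 1 n ε γ δ ≤ 2 * y ^ 7 := by
    rw [hN]
    have h1 : (n : ℝ) * u ^ 2 * Real.log u ^ 2 ≤ y * y ^ 2 * y ^ 2 := by
      have : Real.log u ≤ y := hlu.trans huy
      gcongr
    have h2 : Real.log v ≤ y ^ 5 := (hlv.trans hvy).trans (le_self_pow₀ hy1 (by norm_num))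
    calc u ^ 2 * (n * u ^ 2 * Real.log u ^ 2 + Real.log v)
        ≤ y ^ 2 * (y * y ^ 2 * y ^ 2 + y ^ 5) := by gcongr
      _ = 2 * y ^ 7 := by ring
  have hceil : ((⌈sampleBound 1 n ε γ δ⌉₊ : ℕ) : ℝ) ≤ 2 * y ^ 7 + 1 :=
    (Nat.ceil_lt_add_one hN0).le.trans (by linarith)
  have hy7 : 1 ≤ y ^ 7 := one_le_pow₀ hy1
  push_cast
  calc (C : ℝ) * (⌈sampleBound 1 n ε γ δ⌉₊ + 1) * (n : ℝ) ^ 3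
      ≤ C * (4 * y ^ 7) * y ^ 3 := by
        gcongr
        linarith
    _ = 4 * C * y ^ 10 := by ring

theorem theorem3 :
    ∃ (learner predictor : Turing.TM2ComputableAux Token Token)
      (learn : ∀ n : ℕ, List (SignedPauli n × Outcome) → List (SignedPauli n))
      (C : ℕ) (K : ℝ), 0 < K ∧
      -- labels in {0, 1/2, 1} describe the values of the concepts exactly
      (∀ (n : ℕ) (ρ : QMat n), IsStabiliserState ρ → ∀ P : SignedPauli n,
        (povm P * ρ).trace = (((label ρ P).value : ℝ) : ℂ)) ∧
      -- learning: in time O(m n³), for every number m of examples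
      (∀ (n : ℕ), 1 ≤ n → ∀ ρ : QMat n, IsStabiliserState ρ →
        ∀ (m : ℕ) (x : Fin m → SignedPauli n) (T : List (SignedPauli n × Outcome))
          (L : List (SignedPauli n)) (σ : QMat n),
          T = trainingSet ρ x → L = learn n T → σ = hypothesisState L →
          HaltsWithin learner (encodeTrainingSet T) (encodeGens L) (C * (m + 1) * n ^ 3) ∧
          -- independent generators found in the training set
          L.Sublist (revealed T) ∧ IndependentGens L ∧ genGroup L = genGroup (revealed T) ∧
          IsStabiliserGroup (genGroup L) ∧
          -- the hypothesis is a normalised projector and is consistent with the training set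
          IsIdempotentElem (((2 : ℂ) ^ n / 2 ^ L.length) • σ) ∧
          (∀ η : ℝ, 0 ≤ η → IsConsistent η x ρ σ) ∧
          -- it is exact on everything that the generators generate
          (∀ P : SignedPauli n, (P.unit ∈ genGroup L ∨ P.opp.unit ∈ genGroup L) →
            concept σ P = concept ρ P) ∧
          (∀ P : SignedPauli n, ¬ (P.unit ∈ genGroup L ∨ P.opp.unit ∈ genGroup L) →
            concept σ P = 1 / 2)) ∧
      -- prediction: Tr (E' σ) is computed exactly from the generators in time O(n³)
      (∀ (n : ℕ), 1 ≤ n → ∀ L : List (SignedPauli n), IndependentGens L →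
        IsStabiliserGroup (genGroup L) → ∀ P : SignedPauli n,
          HaltsWithin predictor (encodePauli P ++ encodeGens L)
            [Token.outcome (label (hypothesisState L) P)] (C * n ^ 3)) ∧
      -- generalisation, for every distribution of the measurements
      (∀ (n : ℕ), 1 ≤ n → ∀ ρ : QMat n, IsStabiliserState ρ →
        ∀ (D : PMF (SignedPauli n)) (ε γ δ : ℝ), 0 < ε → 0 < γ → 0 < δ →
        ∀ m : ℕ, sampleBound K n ε γ δ ≤ m →
          1 - δ ≤ sampleProb D m {x | prob D {P | γ <
            |concept (hypothesisState (learn n (trainingSet ρ x))) P - concept ρ P|} ≤ ε}) ∧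
      -- the learning time at the required sample size is polynomial in n, 1/ε, 1/γ, 1/δ
      (∃ (A : ℝ) (c : ℕ), ∀ (n : ℕ), 1 ≤ n → ∀ ε γ δ : ℝ,
        0 < ε → ε < 1 → 0 < γ → γ < 1 → 0 < δ → δ < 1 →
          ((C * (⌈sampleBound K n ε γ δ⌉₊ + 1) * n ^ 3 : ℕ) : ℝ) ≤
            A * ((n : ℝ) / (ε * γ * δ)) ^ c) := by
  refine ⟨machine true, machine false, fun _ T => learnedGens T, 50, 1, one_pos, ?_, ?_, ?_, ?_, ?_⟩
  · rintro n ρ ⟨S, hS, rfl⟩ P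
    exact trace_povm_eq_label hS P
  · rintro n hn ρ ⟨S, hS, rfl⟩ m x T L σ rfl rfl rfl
    have hG := genGroup_revealed_le hS x
    have hst := hS.mono hG
    have hcard := card_learnedGens hst
    have hσ : hypothesisState (learnedGens (trainingSet (stabState S) x)) =
        stabState (genGroup (revealed (trainingSet (stabState S) x))) := by
      rw [hypothesisState, genGroup_learnedGens]
    have hlen : (trainingSet (stabState S) x).length = m := List.length_ofFn
    have hhalt := haltsWithin_learner hn hS (trainingSet (stabState S) x)
      fun P hP => unit_mem_of_mem_revealed hS x hP
    rw [hlen] at hhalt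
    refine ⟨hhalt, learnedGens_sublist _, independentGens_of_card ?_ hcard, genGroup_learnedGens _,
      ?_, ?_, fun η hη => ⟨fun i => ?_, ?_, ?_⟩, fun P hP => ?_, fun P hP => ?_⟩
    · rwa [genGroup_learnedGens]
    · rwa [genGroup_learnedGens]
    · have h := isIdempotentElem_stabProj hst
      rw [stabProj, ← hσ, ← genGroup_learnedGens, hcard] at h
      push_cast at h
      exact h
    · rw [hσ, concept_sample_eq hS x i, sub_self, abs_zero]
      exact hη
    · rw [hσ]
      exact posSemidef_stabState hst
    · rw [hσ]
      exact trace_stabState hst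
    · rw [genGroup_learnedGens] at hP
      rw [hσ]
      exact concept_eq_of_mem hS hG hP
    · rw [genGroup_learnedGens, not_or] at hP
      rw [hσ]
      exact concept_of_not_mem hst hP.1 hP.2
  · intro n hn L hL hS P
    exact haltsWithin_predictor hn L hL hS P
  · rintro n hn ρ ⟨S, hS, rfl⟩ D ε γ δ hε hγ hδ m hm
    exact generalisation hS D hε hγ hδ m hm
  · exact ⟨4 * (50 : ℕ), 10, fun n hn ε γ δ hε hε1 hγ hγ1 hδ hδ1 =>
      running_time_le hn hε hε1 hγ hγ1 hδ hδ1 50⟩
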